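/- For a superpoint $B=\mathbb{R}^{0|s}$ ($s\ge 0$) let $\mathcal{O}_B=\bigwedge\mathbb{R}^s$ be its Grassmann algebra of functions, and let $(\mathcal{O}_B\otimes\mathbb{C})_0$, $(\mathcal{O}_B\otimes\mathbb{C})_1$ be the even and odd parts of its complexification. Complex supermanifolds are described by their functors of points on superpoints; maps between them are superholomorphic if they are natural in $B$ and, locally on $B$-points, holomorphic with $(\mathcal{O}_B\otimes\mathbb{C})_0$-linear differential. Let $\mathrm{SpO}_{\mathbb{C}}(2|1)$ be the group whose $B$-points are the invertible even supermatrices $$L=\begin{pmatrix} a & c & \gamma\\ b & d & \delta\\ \alpha & \beta & e\end{pmatrix},\qquad a,b,c,d,e\in(\mathcal{O}_B\otimes\mathbb{C})_0,\quad \alpha,\beta,\gamma,\delta\in(\mathcal{O}_B\otimes\mathbb{C})_1,$$ with $ad-bc-\gamma\delta=1$, $e^2+2\alpha\beta=1$, $c\alpha-a\beta=e\gamma$ and $d\alpha-b\beta=e\delta$. The group $\mathrm{SC}(\mathbb{P}^{1|1}_{\mathbb{C}})$ of superconformal automorphisms of $\mathbb{P}^{1|1}_{\mathbb{C}}$ is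 realised as the connected component of $\mathrm{SpO}_{\mathbb{C}}(2|1)$ on which the reduction of $e$ (modulo nilpotents) is $1$. The $B$-points of $\mathrm{SL}_{\mathbb{C}}(2)$ are the $2\times 2$ matrices over $(\mathcal{O}_B\otimes\mathbb{C})_0$ of determinant $1$, and the $B$-points of $\mathbb{C}^{0|2}$ are the pairs $(\alpha,\beta)$ of elements of $(\mathcal{O}_B\otimes\mathbb{C})_1$. Put $$S(\alpha,\beta)=\begin{pmatrix} 1+\tfrac12\alpha\beta & 0 & -\beta\\ 0 & 1+\tfrac12\alpha\beta & \alpha\\ \alpha & \beta & 1-\alpha\beta\end{pmatrix}.$$ Then $\mathrm{SL}_{\mathbb{C}}(2)$ and $\mathrm{SC}(\mathbb{P}^{1|1}_{\mathbb{C}})$ are complex super Lie groups of dimensions $3|0$ and $3|2$, and the following hold. 1. The homomorphism $\iota\colon \mathrm{SL}_{\mathbb{C}}(2)\to\mathrm{SC}(\mathbb{P}^{1|1}_{\mathbb{C}})$, $\begin{pmatrix} a&c\\ b&d\end{pmatrix}\mapsto\begin{pmatrix} a&c&0\\ b&d&0\\ 0&0&1\end{pmatrix}$, is an embedding of complex super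 Lie groups. 2. The space of cosets $\mathrm{SL}_{\mathbb{C}}(2)\backslash\mathrm{SC}(\mathbb{P}^{1|1}_{\mathbb{C}})$ (the quotient by left multiplication) exists and is isomorphic to $\mathbb{C}^{0|2}$, the isomorphism sending the coset of $S(\alpha,\beta)$ to $(\alpha,\beta)$. That is, there are bijections $\Psi_B\colon \mathrm{SL}_{\mathbb{C}}(2)(B)\backslash\mathrm{SC}(\mathbb{P}^{1|1}_{\mathbb{C}})(B)\to\mathbb{C}^{0|2}(B)$ with $\Psi_B([S(\alpha,\beta)])=(\alpha,\beta)$ such that $L\mapsto\Psi_B([L])$ is a superholomorphic surjective submersion $\mathrm{SC}(\mathbb{P}^{1|1}_{\mathbb{C}})\to\mathbb{C}^{0|2}$ through which every $\mathrm{SL}_{\mathbb{C}}(2)$-invariant superholomorphic map from $\mathrm{SC}(\mathbb{P}^{1|1}_{\mathbb{C}})$ to a subspace of a finite-dimensional complex linear superspace factors uniquely and superholomorphically. 3. The map $(l,(\alpha,\beta))\mapsto\iota(l)\,S(\alpha,\beta)$ is an isomorphism of complex supermanifolds $\mathrm{SL}_{\mathbb{C}}(2)\times\mathbb{C}^{0|2}\to\mathrm{SC}(\mathbb{P}^{1|1}_{\mathbb{C}})$.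 In particular, for every $B$, every element of $\mathrm{SC}(\mathbb{P}^{1|1}_{\mathbb{C}})(B)$ is in a unique way the product of an element of $\mathrm{SL}_{\mathbb{C}}(2)(B)$ and a supersymmetry transformation $S(\alpha,\beta)$. -/

import Mathlib

open scoped TensorProduct

noncomputable section

namespace SG

/-! ### Superpoints and their complexified function algebras -/

/-- The real Grassmann algebra on `s` generators: the functions on the superpoint `ℝ^{0|s}`. -/
abbrev Gras (s : ℕ) : Type := ExteriorAlgebra ℝ (Fin s → ℝ)

/-- The grade involution of the real Grassmann algebra (each generator is sent to its negative). -/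
def grasInvol (s : ℕ) : Gras s →ₐ[ℝ] Gras s := CliffordAlgebra.involute

/-- A morphism of superpoints `ℝ^{0|t} → ℝ^{0|s}`: an algebra homomorphism of the Grassmann
algebras in the opposite direction that preserves parity. -/
structure SPHom (s t : ℕ) where
  hom : Gras s →ₐ[ℝ] Gras t
  parity : ∀ x, hom (grasInvol s x) = grasInvol t (hom x)

/-- The complexified algebra `𝒪_B ⊗ ℂ` of functions on the superpoint `B = ℝ^{0|s}`. -/
def OB (s : ℕ) : Type := ℂ ⊗[ℝ] Gras s

instance (s : ℕ) : Ring (OB s) := inferInstanceAs (Ring (ℂ ⊗[ℝ] Gras s))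
instance (s : ℕ) : Algebra ℂ (OB s) := inferInstanceAs (Algebra ℂ (ℂ ⊗[ℝ] Gras s))

/-- The expansion of an element of `𝒪_B ⊗ ℂ` in the monomials in the generators. -/
def obBasis (s : ℕ) : Module.Basis (Finset (Fin s)) ℂ (OB s) :=
  (Pi.basisFun ℝ (Fin s)).ExteriorAlgebra.baseChange ℂ

/-- `𝒪_B ⊗ ℂ` is a finite-dimensional complex vector space; we norm it by the maximum of the
absolute values of the coefficients (all norms on it are equivalent). -/
instance (s : ℕ) : NormedAddCommGroup (OB s) :=
  NormedAddCommGroup.induced (OB s) (Finset (Fin s) → ℂ) (obBasis s).equivFun.toLinearMap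
    (obBasis s).equivFun.injective

instance (s : ℕ) : NormedSpace ℂ (OB s) :=
  NormedSpace.induced ℂ (OB s) (Finset (Fin s) → ℂ) (obBasis s).equivFun.toLinearMap

instance (s : ℕ) : FiniteDimensional ℂ (OB s) := Module.Finite.of_basis (obBasis s)

/-- The grade involution of `𝒪_B ⊗ ℂ`. -/
def invol (s : ℕ) : OB s →ₐ[ℂ] OB s :=
  Algebra.TensorProduct.map (AlgHom.id ℂ ℂ) (grasInvol s)

/-- The body (reduction) homomorphism `𝒪_B ⊗ ℂ → ℂ`, killing all generators. -/
def body (s : ℕ) : OB s →ₐ[ℂ] ℂ :=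
  Algebra.TensorProduct.lift (AlgHom.id ℂ ℂ)
    ((Algebra.ofId ℝ ℂ).comp (ExteriorAlgebra.algebraMapInv (M := Fin s → ℝ)))
    (fun _ _ => Commute.all _ _)

/-- The pullback of complexified functions along a morphism of superpoints. -/
def SPHom.ob {s t : ℕ} (φ : SPHom s t) : OB s →ₐ[ℂ] OB t :=
  Algebra.TensorProduct.map (AlgHom.id ℂ ℂ) φ.hom

/-- The sign of a parity. -/
def sgn (k : ZMod 2) : ℂ := if k = 0 then 1 else -1

/-- The part of parity `k` of `𝒪_B ⊗ ℂ`: elements on which the grade involution acts by the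
sign of `k`. So `gr s 0` is the even part and `gr s 1` the odd part. -/
def gr (s : ℕ) (k : ZMod 2) : Submodule ℂ (OB s) where
  carrier := {x | invol s x = sgn k • x}
  add_mem' := by
    intro x y hx hy
    simp only [Set.mem_ofPred_eq] at *
    rw [map_add, hx, hy, smul_add]
  zero_mem' := by simp
  smul_mem' := by
    intro c x hx
    simp only [Set.mem_ofPred_eq] at *
    rw [map_smul, hx, smul_comm]

theorem mem_gr {s : ℕ} {k : ZMod 2} {x : OB s} : x ∈ gr s k ↔ invol s x = sgn k • x := Iff.rfl

theorem sgn_add (k l : ZMod 2) : sgn (k + l) = sgn k * sgn l := by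
  revert k l
  have h : ∀ k : ZMod 2, k = 0 ∨ k = 1 := by decide
  intro k l
  have h2 : (1 : ZMod 2) + 1 = 0 := by decide
  rcases h k with rfl | rfl <;> rcases h l with rfl | rfl <;> simp [sgn, h2]

theorem mul_mem_gr {s : ℕ} {k l : ZMod 2} {x y : OB s} (hx : x ∈ gr s k) (hy : y ∈ gr s l) :
    x * y ∈ gr s (k + l) := by
  rw [mem_gr] at *
  rw [map_mul, hx, hy, sgn_add, smul_mul_smul_comm]

theorem one_mem_gr (s : ℕ) : (1 : OB s) ∈ gr s 0 := by
  rw [mem_gr]; simp [sgn]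

theorem invol_even {s : ℕ} {x : OB s} (hx : x ∈ gr s 0) : invol s x = x := by
  rw [mem_gr] at hx; simpa [sgn] using hx

theorem invol_odd {s : ℕ} {x : OB s} (hx : x ∈ gr s 1) : invol s x = -x := by
  rw [mem_gr] at hx; simpa [sgn] using hx

theorem ob_invol {s t : ℕ} (φ : SPHom s t) (x : OB s) :
    φ.ob (invol s x) = invol t (φ.ob x) := by
  have h : (φ.ob.comp (invol s)) = ((invol t).comp φ.ob) := by
    apply Algebra.TensorProduct.ext'
    intro a b
    change a ⊗ₜ[ℝ] φ.hom (grasInvol s b) = a ⊗ₜ[ℝ] grasInvol t (φ.hom b)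
    rw [φ.parity]
  exact DFunLike.congr_fun h x

theorem ob_mem_gr {s t : ℕ} (φ : SPHom s t) {k : ZMod 2} {x : OB s} (hx : x ∈ gr s k) :
    φ.ob x ∈ gr t k := by
  rw [mem_gr] at *
  rw [← ob_invol, hx, map_smul]

/-! ### Graded commutativity -/

/-- A generator of the Grassmann algebra, as an element of `𝒪_B ⊗ ℂ`. -/
def gen {s : ℕ} (x : Gras s) : OB s := (1 : ℂ) ⊗ₜ[ℝ] x

theorem gras_gen_mul {s : ℕ} (v : Fin s → ℝ) (w : Gras s) :
    ExteriorAlgebra.ι ℝ v * w = grasInvol s w * ExteriorAlgebra.ι ℝ v := by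
  induction w using ExteriorAlgebra.induction with
  | algebraMap r => simp [Algebra.commutes]
  | ι u =>
    have h := ExteriorAlgebra.ι_add_mul_swap (R := ℝ) v u
    have h2 : grasInvol s (ExteriorAlgebra.ι ℝ u) = - ExteriorAlgebra.ι ℝ u :=
      CliffordAlgebra.involute_ι u
    rw [h2, neg_mul]
    exact eq_neg_of_add_eq_zero_left h
  | mul a b ha hb => rw [← mul_assoc, ha, mul_assoc, hb, map_mul, mul_assoc]
  | add a b ha hb => rw [mul_add, ha, hb, map_add, add_mul]

theorem tmul_eq {s : ℕ} (z : ℂ) (w : Gras s) : ((z ⊗ₜ[ℝ] w : ℂ ⊗[ℝ] Gras s) : OB s) = z • gen w := by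
  change z ⊗ₜ[ℝ] w = z • ((1 : ℂ) ⊗ₜ[ℝ] w)
  rw [TensorProduct.smul_tmul', smul_eq_mul, mul_one]

theorem OB.induction {s : ℕ} {P : OB s → Prop} (zero : P 0) (tmul : ∀ (z : ℂ) w, P (z • gen w))
    (add : ∀ a b, P a → P b → P (a + b)) (x : OB s) : P x :=
  TensorProduct.induction_on (motive := P) x zero
    (fun z w => by rw [tmul_eq]; exact tmul z w) add

theorem gen_mul' {s : ℕ} (a b : Gras s) : gen (a * b) = gen a * gen b := by
  have h := Algebra.TensorProduct.tmul_mul_tmul (R := ℝ) (1 : ℂ) 1 a b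
  rw [one_mul] at h
  exact h.symm

theorem gen_add {s : ℕ} (a b : Gras s) : gen (a + b) = gen a + gen b :=
  TensorProduct.tmul_add _ _ _

theorem gen_algebraMap {s : ℕ} (r : ℝ) :
    (gen (algebraMap ℝ (Gras s) r) : OB s) = algebraMap ℂ (OB s) r := by
  change (1 : ℂ) ⊗ₜ[ℝ] (algebraMap ℝ (Gras s) r) = (r : ℂ) ⊗ₜ[ℝ] (1 : Gras s)
  rw [Algebra.algebraMap_eq_smul_one, ← TensorProduct.smul_tmul]
  simp

theorem invol_gen {s : ℕ} (w : Gras s) : invol s (gen w) = gen (grasInvol s w) := rfl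

theorem gen_mul {s : ℕ} (v : Fin s → ℝ) (y : OB s) :
    gen (ExteriorAlgebra.ι ℝ v) * y = invol s y * gen (ExteriorAlgebra.ι ℝ v) := by
  induction y using OB.induction with
  | zero => rw [mul_zero, map_zero, zero_mul]
  | tmul z w =>
    rw [map_smul, invol_gen, mul_smul_comm, smul_mul_assoc, ← gen_mul', ← gen_mul', gras_gen_mul]
  | add a b ha hb => rw [mul_add, map_add, add_mul, ha, hb]

/-- Even elements are central. -/
theorem even_comm {s : ℕ} {y : OB s} (hy : y ∈ gr s 0) (x : OB s) : x * y = y * x := by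
  have hg : ∀ w : Gras s, gen w * y = y * gen w := by
    intro w
    induction w using ExteriorAlgebra.induction with
    | algebraMap r => rw [gen_algebraMap]; exact Algebra.commutes _ _
    | ι v => rw [gen_mul, invol_even hy]
    | mul a b ha hb => rw [gen_mul', mul_assoc, hb, ← mul_assoc, ha, mul_assoc]
    | add a b ha hb => rw [gen_add, add_mul, mul_add, ha, hb]
  induction x using OB.induction with
  | zero => rw [mul_zero, zero_mul]
  | tmul z w => rw [smul_mul_assoc, hg, mul_smul_comm]
  | add a b ha hb => rw [mul_add, add_mul, ha, hb]

/-- Odd elements anticommute. -/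
theorem odd_comm {s : ℕ} {x y : OB s} (hx : x ∈ gr s 1) (hy : y ∈ gr s 1) :
    x * y = -(y * x) := by
  have hg : ∀ w : Gras s, gen w * y = y * invol s (gen w) := by
    intro w
    induction w using ExteriorAlgebra.induction with
    | algebraMap r => rw [gen_algebraMap, AlgHom.commutes]; exact Algebra.commutes _ _
    | ι v =>
      have h2 : grasInvol s (ExteriorAlgebra.ι ℝ v) = - ExteriorAlgebra.ι ℝ v :=
        CliffordAlgebra.involute_ι v
      have h3 : (gen (- ExteriorAlgebra.ι ℝ v : Gras s) : OB s) = - gen (ExteriorAlgebra.ι ℝ v) :=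
        TensorProduct.tmul_neg _ _
      rw [gen_mul, invol_odd hy, invol_gen, h2, h3, mul_neg, neg_mul]
    | mul a b ha hb => rw [gen_mul', mul_assoc, hb, ← mul_assoc, ha, map_mul, mul_assoc]
    | add a b ha hb => rw [gen_add, add_mul, map_add, mul_add, ha, hb]
  have key : ∀ x : OB s, x * y = y * invol s x := by
    intro x
    induction x using OB.induction with
    | zero => rw [map_zero, mul_zero, zero_mul]
    | tmul z w => rw [smul_mul_assoc, hg, map_smul, mul_smul_comm]
    | add a b ha hb => rw [map_add, mul_add, add_mul, ha, hb]
  rw [key, invol_odd hx, mul_neg]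

/-- The commutative algebra `(𝒪_B ⊗ ℂ)₀` of even functions. -/
def Even (s : ℕ) : Subalgebra ℂ (OB s) where
  carrier := gr s 0
  mul_mem' := by
    intro a b ha hb
    have := mul_mem_gr ha hb
    rwa [add_zero] at this
  add_mem' := (gr s 0).add_mem
  algebraMap_mem' := by
    intro r
    rw [Algebra.algebraMap_eq_smul_one]
    exact (gr s 0).smul_mem r (one_mem_gr s)

instance (s : ℕ) : CommRing (Even s) :=
  { (inferInstance : Ring (Even s)) with
    mul_comm := fun a b => Subtype.ext (even_comm b.2 a.1) }

/-- The pullback of even functions along a morphism of superpoints. -/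
def SPHom.even {s t : ℕ} (φ : SPHom s t) : Even s →+* Even t :=
  (φ.ob : OB s →+* OB t).restrict (Even s) (Even t) (fun _ hx => ob_mem_gr φ hx)

/-! ### Complex superdomains and superholomorphic maps -/

/-- The `ℝ^{0|s}`-points of the complex linear superspace whose coordinates are indexed by `ι`,
the coordinate `i` having parity `p i`. -/
abbrev SVec {ι : Type} (p : ι → ZMod 2) (s : ℕ) : Type := ∀ i, gr s (p i)

/-- Functoriality of the points of a linear superspace. -/
def SVec.map {ι : Type} {p : ι → ZMod 2} {s t : ℕ} (φ : SPHom s t) (x : SVec p s) : SVec p t :=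
  fun i => ⟨φ.ob (x i), ob_mem_gr φ (x i).2⟩

/-- The reduced point underlying a point of a linear superspace (its odd coordinates are `0`). -/
def SVec.red {ι : Type} {p : ι → ZMod 2} {s : ℕ} (x : SVec p s) : ι → ℂ :=
  fun i => body s (x i)

/-- The action of even functions on the points of a linear superspace. -/
def SVec.evenSMul {ι : Type} {p : ι → ZMod 2} {s : ℕ} (l : Even s) (x : SVec p s) : SVec p s :=
  fun i => ⟨(l : OB s) * x i, by
    have := mul_mem_gr (k := 0) l.2 (x i).2
    rwa [zero_add] at this⟩

/-- The `ℝ^{0|s}`-points of the open superdomain with underlying open set `U`. -/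
def dom {ι : Type} (p : ι → ZMod 2) (U : Set (ι → ℂ)) (s : ℕ) : Set (SVec p s) :=
  {x | x.red ∈ U}

/-- `f` is a superholomorphic map from the superdomain over `U` to a linear superspace: it is
natural in the superpoint, on the points over each superpoint it is holomorphic, and its
differentials are linear over the even functions. -/
structure SHolOn {ι κ : Type} [Fintype ι] [Fintype κ] {p : ι → ZMod 2} {q : κ → ZMod 2}
    (U : Set (ι → ℂ)) (f : ∀ s, SVec p s → SVec q s) : Prop where
  natural : ∀ (s t : ℕ) (φ : SPHom s t), ∀ x ∈ dom p U s, f t (x.map φ) = (f s x).map φ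
  holo : ∀ s, DifferentiableOn ℂ (f s) (dom p U s)
  evenLinear : ∀ s, ∀ x ∈ dom p U s, ∀ (l : Even s) (v : SVec p s),
    fderiv ℂ (f s) x (v.evenSMul l) = (fderiv ℂ (f s) x v).evenSMul l

/-! ### Supermanifolds inside linear superspaces -/

/-- A functor of points on superpoints that is realised as a subfunctor of a finite-dimensional
complex linear superspace. -/
structure SSpace where
  /-- index set of the ambient coordinates -/
  ι : Type
  fin : Fintype ι
  /-- parities of the ambient coordinates -/
  par : ι → ZMod 2
  /-- the `ℝ^{0|s}`-points -/
  pts : ℕ → Type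
  map : ∀ {s t : ℕ}, SPHom s t → pts s → pts t
  coord : ∀ {s : ℕ}, pts s → SVec par s
  coord_injective : ∀ s, Function.Injective (coord (s := s))
  coord_map : ∀ {s t : ℕ} (φ : SPHom s t) (x : pts s), coord (map φ x) = (coord x).map φ

attribute [instance] SSpace.fin

/-- `X` is a complex supermanifold of dimension `m|n`, as a sub-supermanifold of its ambient
linear superspace: near each point it is the zero locus of a superholomorphic map, submersive
along `X`, to a linear superspace of the complementary dimension. -/
def IsSupermanifold (X : SSpace) (m n : ℕ) : Prop :=
  ∀ (s₀ : ℕ) (x₀ : X.pts s₀), ∃ U : Set (X.ι → ℂ), IsOpen U ∧ (X.coord x₀).red ∈ U ∧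
    ∃ (k : ℕ) (q : Fin k → ZMod 2) (F : ∀ s, SVec X.par s → SVec q s),
      SHolOn U F ∧
      (∀ s, ∀ y ∈ dom X.par U s, (∃ x : X.pts s, X.coord x = y) ↔ F s y = 0) ∧
      (∀ (s : ℕ) (x : X.pts s), X.coord x ∈ dom X.par U s →
        Function.Surjective (fderiv ℂ (F s) (X.coord x))) ∧
      m + Nat.card {j // q j = 0} = Nat.card {i // X.par i = 0} ∧
      n + Nat.card {j // q j = 1} = Nat.card {i // X.par i = 1}

/-- A map of points is superholomorphic if it is natural and locally the restriction of a
superholomorphic map between superdomains of the ambient linear superspaces. -/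
def IsSHol (X Y : SSpace) (f : ∀ s, X.pts s → Y.pts s) : Prop :=
  (∀ (s t : ℕ) (φ : SPHom s t) (x : X.pts s), f t (X.map φ x) = Y.map φ (f s x)) ∧
  ∀ (s₀ : ℕ) (x₀ : X.pts s₀), ∃ U : Set (X.ι → ℂ), IsOpen U ∧ (X.coord x₀).red ∈ U ∧
    ∃ g : ∀ s, SVec X.par s → SVec Y.par s, SHolOn U g ∧
      ∀ (s : ℕ) (x : X.pts s), X.coord x ∈ dom X.par U s → Y.coord (f s x) = g s (X.coord x)

/-- An isomorphism: a superholomorphic map with a superholomorphic inverse. -/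
def IsSIso (X Y : SSpace) (f : ∀ s, X.pts s → Y.pts s) : Prop :=
  IsSHol X Y f ∧ ∃ g : ∀ s, Y.pts s → X.pts s, IsSHol Y X g ∧
    (∀ s x, g s (f s x) = x) ∧ (∀ s y, f s (g s y) = y)

/-- An embedding: an injective superholomorphic map whose inverse, defined on the image, is
superholomorphic, that is, locally the restriction of a superholomorphic map. -/
def IsSEmbedding (X Y : SSpace) (f : ∀ s, X.pts s → Y.pts s) : Prop :=
  IsSHol X Y f ∧ (∀ s, Function.Injective (f s)) ∧
  ∀ (s₀ : ℕ) (x₀ : X.pts s₀), ∃ U : Set (Y.ι → ℂ), IsOpen U ∧ (Y.coord (f s₀ x₀)).red ∈ U ∧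
    ∃ g : ∀ s, SVec Y.par s → SVec X.par s, SHolOn U g ∧
      ∀ (s : ℕ) (x : X.pts s), Y.coord (f s x) ∈ dom Y.par U s →
        X.coord x = g s (Y.coord (f s x))

/-- The linear superspace with coordinates of parities `p`. -/
def linSpace {ι : Type} [h : Fintype ι] (p : ι → ZMod 2) : SSpace where
  ι := ι
  fin := h
  par := p
  pts := SVec p
  map := SVec.map
  coord := id
  coord_injective _ := Function.injective_id
  coord_map _ _ := rfl

/-- The product of two spaces. -/
def prodSpace (X Y : SSpace) : SSpace where
  ι := X.ι ⊕ Y.ι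
  fin := inferInstance
  par := Sum.elim X.par Y.par
  pts s := X.pts s × Y.pts s
  map φ x := (X.map φ x.1, Y.map φ x.2)
  coord x := fun i => match i with
    | Sum.inl i => X.coord x.1 i
    | Sum.inr j => Y.coord x.2 j
  coord_injective s := by
    rintro ⟨a, b⟩ ⟨c, d⟩ h
    have h1 : X.coord a = X.coord c := funext fun i => congrFun h (Sum.inl i)
    have h2 : Y.coord b = Y.coord d := funext fun j => congrFun h (Sum.inr j)
    rw [X.coord_injective s h1, Y.coord_injective s h2]
  coord_map φ x := by
    funext i
    rcases i with i | j
    · exact congrFun (X.coord_map φ x.1) i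
    · exact congrFun (Y.coord_map φ x.2) j

/-- A complex super Lie group of dimension `m|n`: a complex supermanifold whose points form
groups such that multiplication and inversion are superholomorphic (in particular natural). -/
structure IsSuperLieGroup (X : SSpace) [∀ s, Group (X.pts s)] (m n : ℕ) : Prop where
  manifold : IsSupermanifold X m n
  mul : IsSHol (prodSpace X X) X (fun _ x => x.1 * x.2)
  inv : IsSHol X X (fun _ x => x⁻¹)

/-- `π : X → Q` is the quotient of `X` by the action `act` of `G`: it is a surjective submersion
(it has superholomorphic local sections through every reduced point), its fibres on the points
over every superpoint are exactly the orbits, and invariant superholomorphic maps factor uniquely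
and superholomorphically through it. -/
structure IsSQuotient (G X Q : SSpace) (act : ∀ s, G.pts s → X.pts s → X.pts s)
    (π : ∀ s, X.pts s → Q.pts s) : Prop where
  shol : IsSHol X Q π
  surjective : ∀ s, Function.Surjective (π s)
  orbits : ∀ s (x y : X.pts s), π s x = π s y ↔ ∃ g : G.pts s, act s g x = y
  submersion : ∀ x₀ : X.pts 0, ∃ U : Set (Q.ι → ℂ), IsOpen U ∧ (Q.coord (π 0 x₀)).red ∈ U ∧
    ∃ σ : ∀ s, SVec Q.par s → SVec X.par s, SHolOn U σ ∧
      σ 0 (Q.coord (π 0 x₀)) = X.coord x₀ ∧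
      ∀ (s : ℕ) (y : Q.pts s), Q.coord y ∈ dom Q.par U s →
        ∃ x : X.pts s, X.coord x = σ s (Q.coord y) ∧ π s x = y
  universal : ∀ (Y : SSpace) (h : ∀ s, X.pts s → Y.pts s), IsSHol X Y h →
    (∀ s (g : G.pts s) (x : X.pts s), h s (act s g x) = h s x) →
    ∃! h' : ∀ s, Q.pts s → Y.pts s, IsSHol Q Y h' ∧ ∀ s x, h' s (π s x) = h s x

/-! ### The groups `GL_ℂ(2|1)`, `SpO_ℂ(2|1)` and `SC(ℙ^{1|1})` -/

/-- Parities of the rows and columns of a `2|1 × 2|1` supermatrix. -/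
def par3 : Fin 3 → ZMod 2 := ![0, 0, 1]

/-- Parities of the entries of an even `2|1 × 2|1` supermatrix. -/
def matPar (ij : Fin 3 × Fin 3) : ZMod 2 := par3 ij.1 + par3 ij.2

/-- The ring of even `2|1 × 2|1` supermatrices with entries in `𝒪_B ⊗ ℂ`: the upper left
`2 × 2` block and the lower right entry are even, the remaining entries are odd. -/
def SMat (s : ℕ) : Subring (Matrix (Fin 3) (Fin 3) (OB s)) where
  carrier := {M | ∀ i j, M i j ∈ gr s (par3 i + par3 j)}
  mul_mem' := by
    intro M N hM hN i j
    rw [Matrix.mul_apply]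
    refine Submodule.sum_mem _ fun k _ => ?_
    have := mul_mem_gr (hM i k) (hN k j)
    have e : par3 i + par3 k + (par3 k + par3 j) = par3 i + par3 j := by
      generalize par3 i = a
      generalize par3 k = b
      generalize par3 j = c
      revert a b c
      decide
    rwa [e] at this
  one_mem' := by
    intro i j
    rw [Matrix.one_apply]
    split_ifs with h
    · subst h
      have e : par3 i + par3 i = 0 := by
        generalize par3 i = a
        revert a
        decide
      rw [e]
      exact one_mem_gr s
    · exact Submodule.zero_mem _
  add_mem' := fun hM hN i j => Submodule.add_mem _ (hM i j) (hN i j)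
  zero_mem' := fun i j => Submodule.zero_mem _
  neg_mem' := fun hM i j => Submodule.neg_mem _ (hM i j)

/-- The points of `GL_ℂ(2|1)`: invertible even supermatrices. -/
abbrev GL21 (s : ℕ) : Type := (SMat s)ˣ

/-- The matrix entries of a point of `GL_ℂ(2|1)`. -/
def ent {s : ℕ} (L : SMat s) : Matrix (Fin 3) (Fin 3) (OB s) := L.1

/-- The equations of `SpO_ℂ(2|1)` for the supermatrix with rows `(a, c, γ)`, `(b, d, δ)` and
`(α, β, e)`. -/
structure SpEqs {s : ℕ} (M : Matrix (Fin 3) (Fin 3) (OB s)) : Prop where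
  /-- `a d - b c - γ δ = 1` -/
  h1 : M 0 0 * M 1 1 - M 1 0 * M 0 1 - M 0 2 * M 1 2 = 1
  /-- `e² + 2 α β = 1` -/
  h2 : M 2 2 ^ 2 + 2 * (M 2 0 * M 2 1) = 1
  /-- `c α - a β = e γ` -/
  h3 : M 0 1 * M 2 0 - M 0 0 * M 2 1 = M 2 2 * M 0 2
  /-- `d α - b β = e δ` -/
  h4 : M 1 1 * M 2 0 - M 1 0 * M 2 1 = M 2 2 * M 1 2

theorem gr_two {s : ℕ} {x : OB s} (hx : x ∈ gr s ((1 : ZMod 2) + 1)) : x ∈ gr s 0 := by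
  have h : (1 : ZMod 2) + 1 = 0 := by decide
  rwa [h] at hx

theorem odd_sq {s : ℕ} {x : OB s} (hx : x ∈ gr s 1) : x * x = 0 := by
  have h := odd_comm hx hx
  have h2 : (2 : ℂ) • (x * x) = 0 := by
    rw [two_smul]
    nth_rewrite 1 [h]
    exact neg_add_cancel _
  exact (smul_eq_zero.mp h2).resolve_left two_ne_zero

theorem body_odd {s : ℕ} {x : OB s} (hx : x ∈ gr s 1) : body s x = 0 := by
  have h : ((body s).comp (invol s)) = body s := by
    apply Algebra.TensorProduct.ext'
    intro a b
    have h1 : (ExteriorAlgebra.algebraMapInv (M := Fin s → ℝ)).comp (grasInvol s)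
        = ExteriorAlgebra.algebraMapInv (R := ℝ) := by
      apply ExteriorAlgebra.hom_ext
      ext v
      have h2 : ∀ w, grasInvol s (ExteriorAlgebra.ι ℝ w) = - ExteriorAlgebra.ι ℝ w :=
        CliffordAlgebra.involute_ι
      simp [h2, ExteriorAlgebra.algebraMapInv]
    have h3 := DFunLike.congr_fun h1 b
    change a * (algebraMap ℝ ℂ) (ExteriorAlgebra.algebraMapInv (grasInvol s b))
      = a * (algebraMap ℝ ℂ) (ExteriorAlgebra.algebraMapInv b)
    rw [← h3]
    rfl
  have h1 := DFunLike.congr_fun h x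
  rw [AlgHom.comp_apply, invol_odd hx, map_neg] at h1
  have h2 : (2 : ℂ) * body s x = 0 := by linear_combination -h1
  exact (mul_eq_zero.mp h2).resolve_left two_ne_zero

/-- The supermatrix which is inverse to an element of `SpO_ℂ(2|1)`. -/
def adj {s : ℕ} (M : Matrix (Fin 3) (Fin 3) (OB s)) : Matrix (Fin 3) (Fin 3) (OB s) :=
  !![M 1 1, -M 0 1, M 2 1; -M 1 0, M 0 0, -M 2 0; -M 1 2, M 0 2, M 2 2]

theorem adj_adj {s : ℕ} (M : Matrix (Fin 3) (Fin 3) (OB s)) : adj (adj M) = M := by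
  ext i j
  fin_cases i <;> fin_cases j <;> simp [adj]

theorem e00 {s : ℕ} (L : SMat s) : L.1 0 0 ∈ gr s 0 := by
  simpa [par3] using L.2 0 0
theorem e01 {s : ℕ} (L : SMat s) : L.1 0 1 ∈ gr s 0 := by
  simpa [par3] using L.2 0 1
theorem e10 {s : ℕ} (L : SMat s) : L.1 1 0 ∈ gr s 0 := by
  simpa [par3] using L.2 1 0
theorem e11 {s : ℕ} (L : SMat s) : L.1 1 1 ∈ gr s 0 := by
  simpa [par3] using L.2 1 1
theorem e22 {s : ℕ} (L : SMat s) : L.1 2 2 ∈ gr s 0 :=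
  gr_two (L.2 2 2)
theorem o02 {s : ℕ} (L : SMat s) : L.1 0 2 ∈ gr s 1 := by
  simpa [par3] using L.2 0 2
theorem o12 {s : ℕ} (L : SMat s) : L.1 1 2 ∈ gr s 1 := by
  simpa [par3] using L.2 1 2
theorem o20 {s : ℕ} (L : SMat s) : L.1 2 0 ∈ gr s 1 := by
  simpa [par3] using L.2 2 0
theorem o21 {s : ℕ} (L : SMat s) : L.1 2 1 ∈ gr s 1 := by
  simpa [par3] using L.2 2 1

theorem adj_mul {s : ℕ} (M N : SMat s) : adj (M.1 * N.1) = adj N.1 * adj M.1 := by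
  have c := fun (x y : OB s) (h : y ∈ gr s 0) => even_comm h x
  have o := fun (x y : OB s) (hx : x ∈ gr s 1) (hy : y ∈ gr s 1) => odd_comm hx hy
  ext i j
  fin_cases i <;> fin_cases j <;>
    simp only [adj, Matrix.mul_apply, Fin.sum_univ_three, Matrix.of_apply, Matrix.cons_val',
      Matrix.cons_val_zero, Matrix.cons_val_one, Matrix.cons_val, Fin.zero_eta, Fin.mk_one,
      Fin.reduceFinMk, neg_mul, mul_neg, neg_neg]
  · rw [c (M.1 1 0) _ (e01 N), c (M.1 1 1) _ (e11 N), o _ _ (o12 M) (o21 N)]; abel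
  · rw [c (M.1 0 0) _ (e01 N), c (M.1 0 1) _ (e11 N), o _ _ (o02 M) (o21 N)]; abel
  · rw [c (M.1 2 0) _ (e01 N), c (M.1 2 1) _ (e11 N), ← c (N.1 2 1) _ (e22 M)]; abel
  · rw [c (M.1 1 0) _ (e00 N), c (M.1 1 1) _ (e10 N), o _ _ (o12 M) (o20 N)]; abel
  · rw [c (M.1 0 0) _ (e00 N), c (M.1 0 1) _ (e10 N), o _ _ (o02 M) (o20 N)]; abel
  · rw [c (M.1 2 0) _ (e00 N), c (M.1 2 1) _ (e10 N), ← c (N.1 2 0) _ (e22 M)]; abel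
  · rw [← c (N.1 0 2) _ (e10 M), ← c (N.1 1 2) _ (e11 M), c (M.1 1 2) _ (e22 N)]; abel
  · rw [← c (N.1 0 2) _ (e00 M), ← c (N.1 1 2) _ (e01 M), c (M.1 0 2) _ (e22 N)]; abel
  · rw [o _ _ (o20 M) (o02 N), o _ _ (o21 M) (o12 N), c (M.1 2 2) _ (e22 N)]; abel

theorem spEqs_iff {s : ℕ} (M : SMat s) : SpEqs M.1 ↔ M.1 * adj M.1 = 1 := by
  have c := fun (x y : OB s) (h : y ∈ gr s 0) => even_comm h x
  have o := fun (x y : OB s) (hx : x ∈ gr s 1) (hy : y ∈ gr s 1) => odd_comm hx hy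
  constructor
  · intro h
    ext i j
    fin_cases i <;> fin_cases j <;>
      simp only [adj, Matrix.mul_apply, Fin.sum_univ_three, Matrix.of_apply, Matrix.cons_val',
        Matrix.cons_val_zero, Matrix.cons_val_one, Matrix.cons_val, Fin.zero_eta, Fin.mk_one,
        Fin.reduceFinMk, mul_neg, Matrix.one_apply, if_true, Fin.isValue]
    · rw [← h.h1, c (M.1 0 1) _ (e10 M)]; abel
    · rw [c (M.1 0 0) _ (e01 M), odd_sq (o02 M)]; simp
    · have := h.h3
      rw [c (M.1 0 2) _ (e22 M), ← this]; simp; abel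
    · rw [c (M.1 1 0) _ (e11 M), odd_sq (o12 M)]; simp
    · rw [← h.h1, o _ _ (o02 M) (o12 M), c (M.1 0 0) _ (e11 M)]; simp; abel
    · have := h.h4
      rw [c (M.1 1 2) _ (e22 M), ← this]; simp; abel
    · have := h.h4
      rw [← this, c (M.1 2 0) _ (e11 M), c (M.1 2 1) _ (e10 M)]; simp; abel
    · have := h.h3
      rw [← this, c (M.1 2 0) _ (e01 M), c (M.1 2 1) _ (e00 M)]; simp
    · rw [← h.h2, o _ _ (o21 M) (o20 M), two_mul, pow_two]; simp; abel
  · intro h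
    have e := fun i j => congrFun (congrFun h i) j
    have f00 := e 0 0
    have e02 := e 0 2
    have e12 := e 1 2
    have f22 := e 2 2
    simp only [adj, Matrix.mul_apply, Fin.sum_univ_three, Matrix.of_apply, Matrix.cons_val',
        Matrix.cons_val_zero, Matrix.cons_val_one, Matrix.cons_val, Fin.isValue,
        mul_neg, Matrix.one_apply, if_true] at f00 e02 e12 f22
    refine ⟨?_, ?_, ?_, ?_⟩
    · rw [← f00, c (M.1 0 1) _ (e10 M)]; abel
    · rw [← f22, o _ _ (o21 M) (o20 M), two_mul, pow_two]; abel
    · have e02' : M.1 0 0 * M.1 2 1 + -(M.1 0 1 * M.1 2 0) + M.1 0 2 * M.1 2 2 = 0 := by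
        simpa using e02
      rw [c (M.1 0 2) _ (e22 M)] at e02'
      rw [← sub_eq_zero, ← neg_eq_zero, ← e02']; abel
    · have e12' : M.1 1 0 * M.1 2 1 + -(M.1 1 1 * M.1 2 0) + M.1 1 2 * M.1 2 2 = 0 := by
        simpa using e12
      rw [c (M.1 1 2) _ (e22 M)] at e12'
      rw [← sub_eq_zero, ← neg_eq_zero, ← e12']; abel

theorem inv_eq_adj {s : ℕ} (L : GL21 s) (h : SpEqs L.1.1) : (L⁻¹).1.1 = adj L.1.1 := by
  have h1 := (spEqs_iff L.1).mp h
  have h2 : (L⁻¹).1.1 * L.1.1 = 1 := congrArg Subtype.val L.inv_mul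
  calc (L⁻¹).1.1 = (L⁻¹).1.1 * (L.1.1 * adj L.1.1) := by rw [h1, mul_one]
    _ = adj L.1.1 := by rw [← mul_assoc, h2, one_mul]

/-- The points of `SpO_ℂ(2|1)`. -/
def SpO (s : ℕ) : Subgroup (GL21 s) where
  carrier := {L | SpEqs (ent L.1)}
  mul_mem' := by
    intro L N hL hN
    have h1 := (spEqs_iff L.1).mp hL
    have h2 := (spEqs_iff N.1).mp hN
    refine (spEqs_iff (L.1 * N.1)).mpr ?_
    change L.1.1 * N.1.1 * adj (L.1.1 * N.1.1) = 1
    rw [adj_mul, mul_assoc, ← mul_assoc N.1.1, h2, one_mul, h1]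
  one_mem' := by
    refine (spEqs_iff 1).mpr ?_
    ext i j
    fin_cases i <;> fin_cases j <;> simp [adj]
  inv_mem' := by
    intro L hL
    refine (spEqs_iff (L⁻¹).1).mpr ?_
    have h := inv_eq_adj L hL
    have h2 : (L⁻¹).1.1 * L.1.1 = 1 := congrArg Subtype.val L.inv_mul
    rw [h] at h2 ⊢
    rwa [adj_adj]

/-- The points of `SC(ℙ^{1|1})`, realised as the connected component of `SpO_ℂ(2|1)` on which the
reduction of the lower right entry is `1`. -/
def SC (s : ℕ) : Subgroup (GL21 s) where
  carrier := {L | L ∈ SpO s ∧ body s (ent L.1 2 2) = 1}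
  mul_mem' := by
    rintro L N ⟨hL, hL'⟩ ⟨hN, hN'⟩
    refine ⟨mul_mem hL hN, ?_⟩
    change body s ((L.1.1 * N.1.1) 2 2) = 1
    have h1 : body s (L.1.1 2 2) = 1 := hL'
    have h2 : body s (N.1.1 2 2) = 1 := hN'
    rw [Matrix.mul_apply, Fin.sum_univ_three, map_add, map_add, map_mul, map_mul, map_mul,
      body_odd (o20 L.1), body_odd (o21 L.1), h1, h2]
    simp
  one_mem' := ⟨one_mem _, by
    change body s ((1 : Matrix (Fin 3) (Fin 3) (OB s)) 2 2) = 1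
    simp⟩
  inv_mem' := by
    rintro L ⟨hL, hL'⟩
    refine ⟨inv_mem hL, ?_⟩
    change body s ((L⁻¹).1.1 2 2) = 1
    rw [inv_eq_adj L hL]
    exact hL'

/-- The matrix entries of a point of `SC(ℙ^{1|1})`. -/
def SC.mat {s : ℕ} (L : SC s) : Matrix (Fin 3) (Fin 3) (OB s) := ent L.1.1

theorem SC.mat_injective (s : ℕ) : Function.Injective (SC.mat (s := s)) := by
  intro L N h
  exact Subtype.ext (Units.ext (Subtype.ext h))

theorem body_ob {s t : ℕ} (φ : SPHom s t) (x : OB s) : body t (φ.ob x) = body s x := by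
  have h : (body t).comp φ.ob = body s := by
    apply Algebra.TensorProduct.ext'
    intro a b
    have h1 : (ExteriorAlgebra.algebraMapInv (M := Fin t → ℝ)).comp φ.hom
        = ExteriorAlgebra.algebraMapInv (R := ℝ) := by
      apply ExteriorAlgebra.hom_ext
      ext v
      have h2 : grasInvol s (ExteriorAlgebra.ι ℝ (Pi.single v 1))
          = - ExteriorAlgebra.ι ℝ (Pi.single v 1) := CliffordAlgebra.involute_ι _
      have h3 := ExteriorAlgebra.comp_ι_sq_zero
        ((ExteriorAlgebra.algebraMapInv (M := Fin t → ℝ)).comp φ.hom) (Pi.single v (1 : ℝ))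
      have h4 := mul_self_eq_zero.mp h3
      simpa [ExteriorAlgebra.algebraMapInv] using h4
    have h3 := DFunLike.congr_fun h1 b
    change a * (algebraMap ℝ ℂ) (ExteriorAlgebra.algebraMapInv (φ.hom b))
      = a * (algebraMap ℝ ℂ) (ExteriorAlgebra.algebraMapInv b)
    rw [← h3]
    rfl
  exact DFunLike.congr_fun h x

/-- Entrywise pullback of even supermatrices along a morphism of superpoints. -/
def SMat.map {s t : ℕ} (φ : SPHom s t) : SMat s →+* SMat t :=
  ((φ.ob : OB s →+* OB t).mapMatrix).restrict (SMat s) (SMat t)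
    (fun _ hM i j => ob_mem_gr φ (hM i j))

theorem SMat.map_adj {s t : ℕ} (φ : SPHom s t) (M : SMat s) :
    adj (SMat.map φ M).1 = ((φ.ob : OB s →+* OB t).mapMatrix) (adj M.1) := by
  ext i j
  fin_cases i <;> fin_cases j <;> simp [adj] <;> rfl

/-- Functoriality of the points of `SC(ℙ^{1|1})`. -/
def SC.map {s t : ℕ} (φ : SPHom s t) (L : SC s) : SC t :=
  ⟨Units.map (SMat.map φ : SMat s →* SMat t) L.1, by
    refine ⟨(spEqs_iff (SMat.map φ L.1.1)).mpr ?_, ?_⟩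
    · have h := (spEqs_iff L.1.1).mp L.2.1
      rw [SMat.map_adj]
      change ((φ.ob : OB s →+* OB t).mapMatrix) L.1.1.1 *
        ((φ.ob : OB s →+* OB t).mapMatrix) (adj L.1.1.1) = 1
      rw [← map_mul, h, map_one]
    · change body t (φ.ob (L.1.1.1 2 2)) = 1
      rw [body_ob]
      exact L.2.2⟩

/-- `SC(ℙ^{1|1})` with the matrix entries as coordinates in `ℂ^{5|4}`. -/
def SCSpace : SSpace where
  ι := Fin 3 × Fin 3
  fin := inferInstance
  par := matPar
  pts s := SC s
  map := SC.map
  coord L := fun ij => ⟨SC.mat L ij.1 ij.2, L.1.1.2 ij.1 ij.2⟩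
  coord_injective s L N h := SC.mat_injective s <| by
    ext i j
    exact congrArg Subtype.val (congrFun h (i, j))
  coord_map _ _ := rfl

instance (s : ℕ) : Group (SCSpace.pts s) := inferInstanceAs (Group (SC s))

/-! ### The group `SL_ℂ(2)` and its embedding -/

/-- The points of `SL_ℂ(2)`: two by two matrices of determinant `1` over the even functions. -/
abbrev SL2 (s : ℕ) : Type := Matrix.SpecialLinearGroup (Fin 2) (Even s)

/-- `SL_ℂ(2)` with the matrix entries as coordinates in `ℂ^{4|0}`. -/
def SL2Space : SSpace where
  ι := Fin 2 × Fin 2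
  fin := inferInstance
  par _ := 0
  pts s := SL2 s
  map φ l := Matrix.SpecialLinearGroup.map φ.even l
  coord l := fun ij => ⟨(l.1 ij.1 ij.2).1, (l.1 ij.1 ij.2).2⟩
  coord_injective s l m h := by
    ext i j
    exact congrArg Subtype.val (congrFun h (i, j))
  coord_map _ _ := rfl

instance (s : ℕ) : Group (SL2Space.pts s) := inferInstanceAs (Group (SL2 s))

/-- The block diagonal supermatrix with upper left block `m` and lower right entry `1`. -/
def blockMat {s : ℕ} (m : Matrix (Fin 2) (Fin 2) (Even s)) : Matrix (Fin 3) (Fin 3) (OB s) :=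
  !![m 0 0, m 0 1, 0; m 1 0, m 1 1, 0; 0, 0, 1]

/-- The block diagonal embedding of two by two matrices over the even functions into the even
supermatrices. -/
def blockHom (s : ℕ) : Matrix (Fin 2) (Fin 2) (Even s) →* SMat s where
  toFun m := ⟨blockMat m, by
    intro i j
    fin_cases i <;> fin_cases j
    · exact (show (0 : ZMod 2) + 0 = 0 by decide) ▸ (m 0 0).2
    · exact (show (0 : ZMod 2) + 0 = 0 by decide) ▸ (m 0 1).2
    · exact Submodule.zero_mem _
    · exact (show (0 : ZMod 2) + 0 = 0 by decide) ▸ (m 1 0).2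
    · exact (show (0 : ZMod 2) + 0 = 0 by decide) ▸ (m 1 1).2
    · exact Submodule.zero_mem _
    · exact Submodule.zero_mem _
    · exact Submodule.zero_mem _
    · exact (show (1 : ZMod 2) + 1 = 0 by decide) ▸ one_mem_gr s⟩
  map_one' := by
    apply Subtype.ext
    ext i j
    fin_cases i <;> fin_cases j <;> simp [blockMat]
  map_mul' m n := by
    apply Subtype.ext
    ext i j
    fin_cases i <;> fin_cases j <;>
      simp [blockMat, Matrix.mul_apply, Fin.sum_univ_two]

theorem blockHom_mem {s : ℕ} (l : SL2 s) (u : GL21 s) (hu : u.1 = blockHom s l.1) :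
    u ∈ SC s := by
  have hd : l.1 0 0 * l.1 1 1 - l.1 0 1 * l.1 1 0 = 1 := by
    rw [← Matrix.det_fin_two]; exact l.2
  have hd' : (l.1 0 0 : OB s) * l.1 1 1 - l.1 1 0 * l.1 0 1 = 1 := by
    rw [mul_comm (l.1 0 1)] at hd
    exact congrArg Subtype.val hd
  have hm : ent u.1 = blockMat l.1 := congrArg Subtype.val hu
  refine ⟨?_, ?_⟩
  · change SpEqs (ent u.1)
    rw [hm]
    exact ⟨by simpa [blockMat] using hd', by simp [blockMat], by simp [blockMat],
      by simp [blockMat]⟩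
  · rw [hm]
    simp [blockMat]

/-- The group homomorphism `SL_ℂ(2) → SC(ℙ^{1|1})`, `l ↦ diag(l, 1)`. -/
def toSC (s : ℕ) : SL2 s →* SC s :=
  (((blockHom s).comp Matrix.SpecialLinearGroup.coeMonoidHom).toHomUnits).codRestrict (SC s)
    (fun l => blockHom_mem l _ rfl)

/-! ### Supersymmetry transformations -/

/-- Two odd coordinates. -/
def oddPar (_ : Fin 2) : ZMod 2 := 1

/-- The linear superspace `ℂ^{0|2}`. -/
def C02 : SSpace := linSpace oddPar

/-- The supersymmetry matrix with parameters `α`, `β`. -/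
def susyMat {s : ℕ} (α β : OB s) : Matrix (Fin 3) (Fin 3) (OB s) :=
  !![1 + (1 / 2 : ℂ) • (α * β), 0, -β;
     0, 1 + (1 / 2 : ℂ) • (α * β), α;
     α, β, 1 - α * β]

theorem susyMat_mem {s : ℕ} {α β : OB s} (hα : α ∈ gr s 1) (hβ : β ∈ gr s 1) :
    susyMat α β ∈ SMat s := by
  have h := gr_two (mul_mem_gr hα hβ)
  have h0 : (0 : ZMod 2) + 0 = 0 := by decide
  have h1 : (1 : ZMod 2) + 1 = 0 := by decide
  have h2 : (0 : ZMod 2) + 1 = 1 := by decide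
  have h3 : (1 : ZMod 2) + 0 = 1 := by decide
  have hd : 1 + (1 / 2 : ℂ) • (α * β) ∈ gr s 0 :=
    Submodule.add_mem _ (one_mem_gr s) (Submodule.smul_mem _ _ h)
  intro i j
  fin_cases i <;> fin_cases j
  · exact h0.symm ▸ hd
  · exact Submodule.zero_mem _
  · exact h2.symm ▸ Submodule.neg_mem _ hβ
  · exact Submodule.zero_mem _
  · exact h0.symm ▸ hd
  · exact h2.symm ▸ hα
  · exact h3.symm ▸ hα
  · exact h3.symm ▸ hβ
  · exact h1.symm ▸ Submodule.sub_mem _ (one_mem_gr s) h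

theorem susyMat_eqs {s : ℕ} {α β : OB s} (hα : α ∈ gr s 1) (hβ : β ∈ gr s 1) :
    SpEqs (susyMat α β) := by
  have ha := odd_sq hα
  have hb := odd_sq hβ
  have hba : β * α = -(α * β) := odd_comm hβ hα
  have h1 : α * β * (α * β) = 0 := by
    rw [mul_assoc, ← mul_assoc β, hba, neg_mul, mul_assoc, hb]; simp
  have h2 : α * β * α = 0 := by
    rw [mul_assoc, hba, mul_neg, ← mul_assoc, ha]; simp
  have h3 : α * β * β = 0 := by rw [mul_assoc, hb, mul_zero]
  have hh : (1 / 2 : ℂ) • (α * β) + (1 / 2 : ℂ) • (α * β) = α * β := by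
    rw [← add_smul]; norm_num
  refine ⟨?_, ?_, ?_, ?_⟩
  · simp only [susyMat, Matrix.of_apply, Matrix.cons_val', Matrix.cons_val_zero,
      Matrix.cons_val_one, Matrix.cons_val, Fin.isValue]
    rw [neg_mul, hba, mul_add, add_mul, add_mul, smul_mul_smul_comm, h1, one_mul, mul_one,
      one_mul, smul_zero, zero_mul, sub_zero, neg_neg, add_zero, add_assoc, hh, add_sub_cancel_right]
  · simp only [susyMat, Matrix.of_apply, Matrix.cons_val', Matrix.cons_val_zero,
      Matrix.cons_val_one, Matrix.cons_val, Fin.isValue]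
    rw [pow_two, mul_sub, sub_mul, sub_mul, h1, two_mul]
    simp
  · simp [susyMat, add_mul, sub_mul, h3]
  · simp [susyMat, add_mul, sub_mul, h2]

theorem susyMat_adj {s : ℕ} (α β : OB s) : adj (susyMat α β) = susyMat (-α) (-β) := by
  ext i j
  fin_cases i <;> fin_cases j <;> simp [adj, susyMat]

/-- The supersymmetry transformation with parameters `v = (α, β)`, as a point of `SC(ℙ^{1|1})`. -/
def susy (s : ℕ) (v : SVec oddPar s) : SC s :=
  ⟨⟨⟨susyMat (v 0) (v 1), susyMat_mem (v 0).2 (v 1).2⟩,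
    ⟨susyMat (-(v 0)) (-(v 1)), susyMat_mem (-(v 0)).2 (-(v 1)).2⟩,
    by
      apply Subtype.ext
      have h := (spEqs_iff ⟨_, susyMat_mem (v 0).2 (v 1).2⟩).mp (susyMat_eqs (v 0).2 (v 1).2)
      rw [susyMat_adj] at h
      exact h,
    by
      apply Subtype.ext
      have h := (spEqs_iff ⟨_, susyMat_mem (-(v 0)).2 (-(v 1)).2⟩).mp
        (susyMat_eqs (-(v 0)).2 (-(v 1)).2)
      rw [susyMat_adj] at h
      simpa using h⟩,
    susyMat_eqs (v 0).2 (v 1).2, by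
      change body s (1 - (v 0 : OB s) * v 1) = 1
      rw [map_sub, map_mul, body_odd (v 0).2]
      simp⟩

/-! ### The space of cosets -/

/-- The `ℝ^{0|s}`-points of the coset space `SL_ℂ(2) \ SC(ℙ^{1|1})`: the classes `SL_ℂ(2) · L`. -/
abbrev Coset (s : ℕ) : Type := Quotient (QuotientGroup.rightRel (toSC s).range)

/-- The class `SL_ℂ(2) · L` of `L`. -/
def cosetMk (s : ℕ) (L : SC s) : Coset s := Quotient.mk _ L

/-- The action of `SL_ℂ(2)` on `SC(ℙ^{1|1})` by left multiplication. -/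
def leftAct (s : ℕ) (l : SL2 s) (L : SC s) : SC s := toSC s l * L

end SG

end

noncomputable section

namespace SG

/-! ### Scalar superholomorphic functions on linear superspaces -/

section Scalar

set_option linter.unusedSectionVars false

variable {ι κ : Type} [Fintype ι] [Fintype κ] {p : ι → ZMod 2} {q : κ → ZMod 2}

/-! The defining equations can be solved explicitly. Put k = αβ, so k² = 0. On the component where e
reduces to 1, the equation e² + 2k = 1 forces e = 1 - k: the difference e - (1 - k) is annihilated
by e + 1 - k, which is 2 plus a nilpotent, hence a unit (`eq_one_sub_of_sq`). This rests on even
functions with zero body being nilpotent (`isNilpotent_of_body_eq_zero`). Since e⁻¹ = 1 + k and k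
kills every even combination of α and β, the third and fourth equations become γ = cα - aβ and δ =
dα - bβ. Then γδ = (ad - bc)k, so the first equation says ad - bc = 1 + k. Thus `sCEqs_iff`
describes a point by its odd row (α, β) and an upper left block of determinant 1 + k.

Multiplying that block by the scalar 1 - k/2 brings its determinant to (1 - k)(1 + k) = 1, and 1 -
k/2 is inverse to the diagonal entry 1 + k/2 of S(α, β). This gives L = ι(l) S(α, β)
(`SC.toSC_even_mul_susy_odd`). Conversely, the last row of ι(l) S(α, β) begins with α, β, and
cancelling S(α, β) recovers l. Hence two points lie in the same left orbit exactly when their odd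
rows agree (`SC.odd_eq_iff`).

All maps involved, inverses included, are polynomial in the matrix entries, so superholomorphy
reduces to the closure of `SHolFun` under ring operations together with `isSHol_of_global`. The
solved equations also give the supermanifold structure: two of them determine γ and δ, one
determines e, and the determinant is submersive along scalings of the block. The quotient map reads
off the odd row; S is a global section of it, so an invariant map h factors as h ∘ S, and in no
other way. -/

/-- Multiplication of `𝒪_B ⊗ ℂ` as a continuous bilinear map. -/
def mulCLM (s : ℕ) : OB s →L[ℂ] OB s →L[ℂ] OB s :=
  (LinearMap.mul ℂ (OB s)).toContinuousBilinearMap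

/-- A superholomorphic function on a linear superspace, with values in `𝒪_B ⊗ ℂ`. -/
structure SHolFun (f : ∀ s, SVec p s → OB s) : Prop where
  natural : ∀ (s t : ℕ) (φ : SPHom s t) (x : SVec p s), f t (x.map φ) = φ.ob (f s x)
  differentiable : ∀ s, Differentiable ℂ (f s)
  evenLinear : ∀ s (x : SVec p s) (l : Even s) (v : SVec p s),
    fderiv ℂ (f s) x (v.evenSMul l) = (l : OB s) * fderiv ℂ (f s) x v

/-- A coordinate, as a continuous linear function. -/
def coordCLM (p : ι → ZMod 2) (i : ι) (s : ℕ) : SVec p s →L[ℂ] OB s :=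
  (gr s (p i)).subtypeL.comp (ContinuousLinearMap.proj i)

theorem fderiv_coord (i : ι) (s : ℕ) (x v : SVec p s) :
    fderiv ℂ (fun x : SVec p s => (x i : OB s)) x v = v i := by
  change fderiv ℂ (coordCLM p i s) x v = v i
  rw [ContinuousLinearMap.fderiv]
  rfl

namespace SHolFun

variable {f g : ∀ s, SVec p s → OB s}

theorem coord (i : ι) : SHolFun (fun s (x : SVec p s) => (x i : OB s)) where
  natural _ _ _ _ := rfl
  differentiable s := (coordCLM p i s).differentiable
  evenLinear s x l v := by rw [fderiv_coord, fderiv_coord]; rfl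

theorem const (c : ℂ) : SHolFun (fun s (_ : SVec p s) => algebraMap ℂ (OB s) c) where
  natural _ _ φ _ := (φ.ob.commutes c).symm
  differentiable _ := differentiable_const _
  evenLinear s x l v := by simp

theorem one : SHolFun (fun s (_ : SVec p s) => (1 : OB s)) := by
  simpa using const (p := p) 1

theorem zero : SHolFun (fun s (_ : SVec p s) => (0 : OB s)) := by
  simpa using const (p := p) 0

theorem fderiv_add (hf : SHolFun f) (hg : SHolFun g) (s : ℕ) (x v : SVec p s) :
    fderiv ℂ (fun x => f s x + g s x) x v = fderiv ℂ (f s) x v + fderiv ℂ (g s) x v := by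
  rw [fderiv_fun_add (𝕜 := ℂ) (E := SVec p s) (F := OB s) (hf.differentiable s x)
    (hg.differentiable s x)]
  rfl

theorem fderiv_neg (s : ℕ) (x v : SVec p s) :
    fderiv ℂ (fun x => -f s x) x v = -fderiv ℂ (f s) x v := by
  rw [fderiv_fun_neg (𝕜 := ℂ) (E := SVec p s) (F := OB s)]
  rfl

theorem fderiv_sub (hf : SHolFun f) (hg : SHolFun g) (s : ℕ) (x v : SVec p s) :
    fderiv ℂ (fun x => f s x - g s x) x v = fderiv ℂ (f s) x v - fderiv ℂ (g s) x v := by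
  rw [fderiv_fun_sub (𝕜 := ℂ) (E := SVec p s) (F := OB s) (hf.differentiable s x)
    (hg.differentiable s x)]
  rfl

theorem fderiv_smul (hf : SHolFun f) (c : ℂ) (s : ℕ) (x v : SVec p s) :
    fderiv ℂ (fun x => c • f s x) x v = c • fderiv ℂ (f s) x v := by
  rw [fderiv_fun_const_smul (𝕜 := ℂ) (E := SVec p s) (F := OB s) (hf.differentiable s x)]
  rfl

theorem hasFDerivAt_mul (hf : SHolFun f) (hg : SHolFun g) (s : ℕ) (x : SVec p s) :
    HasFDerivAt (fun x => f s x * g s x)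
      ((mulCLM s).precompR _ (f s x) (fderiv ℂ (g s) x) +
        (mulCLM s).precompL _ (fderiv ℂ (f s) x) (g s x)) x :=
  (mulCLM s).hasFDerivAt_of_bilinear (hf.differentiable s x).hasFDerivAt
    (hg.differentiable s x).hasFDerivAt

theorem fderiv_mul (hf : SHolFun f) (hg : SHolFun g) (s : ℕ) (x v : SVec p s) :
    fderiv ℂ (fun x => f s x * g s x) x v =
      f s x * fderiv ℂ (g s) x v + fderiv ℂ (f s) x v * g s x := by
  rw [(hf.hasFDerivAt_mul hg s x).fderiv]
  rfl

theorem add (hf : SHolFun f) (hg : SHolFun g) : SHolFun (fun s x => f s x + g s x) where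
  natural s t φ x := by rw [hf.natural, hg.natural, map_add]
  differentiable s := Differentiable.fun_add (𝕜 := ℂ) (E := SVec p s) (F := OB s)
    (hf.differentiable s) (hg.differentiable s)
  evenLinear s x l v := by
    rw [hf.fderiv_add hg, hf.fderiv_add hg, hf.evenLinear, hg.evenLinear, mul_add]

theorem neg (hf : SHolFun f) : SHolFun (fun s x => -f s x) where
  natural s t φ x := by rw [hf.natural, map_neg]
  differentiable s := Differentiable.fun_neg (𝕜 := ℂ) (E := SVec p s) (F := OB s)
    (hf.differentiable s)
  evenLinear s x l v := by rw [fderiv_neg, fderiv_neg, hf.evenLinear, mul_neg]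

theorem sub (hf : SHolFun f) (hg : SHolFun g) : SHolFun (fun s x => f s x - g s x) := by
  simpa only [sub_eq_add_neg] using hf.add hg.neg

theorem smul (c : ℂ) (hf : SHolFun f) : SHolFun (fun s x => c • f s x) where
  natural s t φ x := by rw [hf.natural, map_smul]
  differentiable s := Differentiable.fun_const_smul (𝕜 := ℂ) (E := SVec p s) (F := OB s)
    (hf.differentiable s) c
  evenLinear s x l v := by
    rw [hf.fderiv_smul, hf.fderiv_smul, hf.evenLinear, mul_smul_comm]

/-- In the Leibniz rule one summand has the even scalar in the middle of a product; linearity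
survives because even elements are central. -/
theorem mul (hf : SHolFun f) (hg : SHolFun g) : SHolFun (fun s x => f s x * g s x) where
  natural s t φ x := by rw [hf.natural, hg.natural, map_mul]
  differentiable s x := (hf.hasFDerivAt_mul hg s x).differentiableAt
  evenLinear s x l v := by
    rw [hf.fderiv_mul hg, hf.fderiv_mul hg, hf.evenLinear, hg.evenLinear, mul_add, ← mul_assoc,
      even_comm l.2, mul_assoc, mul_assoc]

theorem sum {α : Type} (S : Finset α) {f : α → ∀ s, SVec p s → OB s} (hf : ∀ a, SHolFun (f a)) :
    SHolFun (fun s x => ∑ a ∈ S, f a s x) := by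
  classical
  induction S using Finset.induction_on with
  | empty => simpa using zero
  | insert a S ha ih => simpa only [Finset.sum_insert ha] using (hf a).add ih

end SHolFun

/-! ### From scalar functions to maps between linear superspaces -/

/-- A linear projection of `𝒪_B ⊗ ℂ` onto its part of parity `k`. -/
theorem exists_gr_proj (s : ℕ) (k : ZMod 2) :
    ∃ P : OB s →L[ℂ] gr s k, ∀ x : gr s k, P x = x := by
  obtain ⟨P, hP⟩ := (gr s k).subtype.exists_leftInverse_of_injective (Submodule.ker_subtype _)
  exact ⟨LinearMap.toContinuousLinearMap P, fun x => DFunLike.congr_fun hP x⟩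

/-- A coordinate takes values in a graded part of the algebra. Composing it with a continuous linear
retraction onto that part turns differentiability in the whole algebra into differentiability in the
part. -/
theorem differentiableAt_of_components {s : ℕ} {f : SVec p s → SVec q s} {x : SVec p s}
    (h : ∀ j, DifferentiableAt ℂ (fun x => (f x j : OB s)) x) : DifferentiableAt ℂ f x := by
  refine (differentiableAt_pi (𝕜 := ℂ) (E := SVec p s) (F' := fun j => gr s (q j))).2 fun j => ?_
  obtain ⟨P, hP⟩ := exists_gr_proj s (q j)
  have := DifferentiableAt.comp (𝕜 := ℂ) (E := SVec p s) (F := OB s) (G := gr s (q j)) x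
    P.differentiableAt (h j)
  refine this.congr_of_eventuallyEq (Filter.Eventually.of_forall fun y => ?_)
  exact (hP _).symm

theorem fderiv_component {s : ℕ} {f : SVec p s → SVec q s} {x : SVec p s}
    (h : DifferentiableAt ℂ f x) (v : SVec p s) (j : κ) :
    (fderiv ℂ f x v j : OB s) = fderiv ℂ (fun x => (f x j : OB s)) x v := by
  have := (HasFDerivAt.comp (𝕜 := ℂ) (E := SVec p s) (F := SVec q s) (G := OB s) x
    (coordCLM q j s).hasFDerivAt h.hasFDerivAt).fderiv
  exact (DFunLike.congr_fun this v).symm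

theorem sHolOn_of_components {f : ∀ s, SVec p s → SVec q s}
    (h : ∀ j, SHolFun (fun s x => (f s x j : OB s))) (U : Set (ι → ℂ)) : SHolOn U f where
  natural s t φ x _ := by
    funext j
    exact Subtype.ext ((h j).natural s t φ x)
  holo s x _ := (differentiableAt_of_components
    fun j => (h j).differentiable s x).differentiableWithinAt
  evenLinear s x _ l v := by
    have hd := differentiableAt_of_components fun j => (h j).differentiable s x
    funext j
    apply Subtype.ext
    rw [fderiv_component hd]
    exact ((h j).evenLinear s x l v).trans
      (congrArg ((l : OB s) * ·) (fderiv_component hd v j).symm)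

theorem isOpen_dom {U : Set (ι → ℂ)} (hU : IsOpen U) (s : ℕ) : IsOpen (dom p U s) := by
  refine hU.preimage (continuous_pi fun i => ?_)
  exact ((LinearMap.toContinuousLinearMap (body s).toLinearMap).continuous.comp
    (coordCLM p i s).continuous)

/-- The chain rule, in the only form needed: an everywhere defined inner map whose image stays
inside the domain of the outer one. -/
theorem SHolOn.comp_of_mapsTo {μ : Type} [Fintype μ] {r : μ → ZMod 2} {V : Set (κ → ℂ)}
    (hV : IsOpen V) {g : ∀ s, SVec q s → SVec r s} (hg : SHolOn V g)
    {f : ∀ s, SVec p s → SVec q s} (hf : SHolOn Set.univ f)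
    (hfV : ∀ s x, f s x ∈ dom q V s) : SHolOn Set.univ (fun s x => g s (f s x)) := by
  have hdf : ∀ s x, DifferentiableAt ℂ (f s) x := fun s x =>
    (hf.holo s).differentiableAt (by simp [dom])
  have hdg : ∀ s x, DifferentiableAt ℂ (g s) (f s x) := fun s x =>
    (hg.holo s).differentiableAt ((isOpen_dom hV s).mem_nhds (hfV s x))
  have hu : ∀ s (x : SVec p s), x ∈ dom p Set.univ s := fun _ _ => Set.mem_univ _
  refine ⟨fun s t φ x hx => ?_, fun s x _ => ?_, fun s x hx l v => ?_⟩
  · rw [hf.natural s t φ x hx, hg.natural s t φ _ (hfV s x)]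
  · exact (DifferentiableAt.comp (𝕜 := ℂ) (E := SVec p s) (F := SVec q s) (G := SVec r s) x
      (hdg s x) (hdf s x)).differentiableWithinAt
  · have := fderiv_comp (𝕜 := ℂ) (E := SVec p s) (F := SVec q s) (G := SVec r s) x
      (hdg s x) (hdf s x)
    change fderiv ℂ (g s ∘ f s) x _ = SVec.evenSMul l (fderiv ℂ (g s ∘ f s) x v)
    rw [this]
    change fderiv ℂ (g s) (f s x) (fderiv ℂ (f s) x _) = _
    rw [hf.evenLinear s x hx, hg.evenLinear s _ (hfV s x)]
    rfl

end Scalar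

/-- A map of points which is globally the restriction of a superholomorphic map between the
ambient linear superspaces is superholomorphic. -/
theorem isSHol_of_global {X Y : SSpace} {f : ∀ s, X.pts s → Y.pts s}
    {g : ∀ s, SVec X.par s → SVec Y.par s} (hg : ∀ j, SHolFun (fun s x => (g s x j : OB s)))
    (h : ∀ s x j, (Y.coord (f s x) j : OB s) = g s (X.coord x) j) : IsSHol X Y f := by
  have hgU := sHolOn_of_components hg Set.univ
  have h' : ∀ s x, Y.coord (f s x) = g s (X.coord x) := fun s x =>
    funext fun j => Subtype.ext (h s x j)
  refine ⟨fun s t φ x => Y.coord_injective t ?_, fun s₀ x₀ =>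
    ⟨Set.univ, isOpen_univ, Set.mem_univ _, g, hgU, fun s x _ => h' s x⟩⟩
  -- Naturality is inherited from the ambient map, since coordinates are injective and commute with
  -- pullback.
  rw [h', X.coord_map, hgU.natural s t φ _ (Set.mem_univ _), Y.coord_map, h']

/-! ### Even functions with vanishing reduction are nilpotent -/

section Nilpotent

variable {s : ℕ}

/-- The even part of an element of `𝒪_B ⊗ ℂ`. -/
def evenPart (s : ℕ) : OB s →ₗ[ℂ] OB s := (1 / 2 : ℂ) • (LinearMap.id + (invol s).toLinearMap)

/-- The odd part of an element of `𝒪_B ⊗ ℂ`. -/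
def oddPart (s : ℕ) : OB s →ₗ[ℂ] OB s := (1 / 2 : ℂ) • (LinearMap.id - (invol s).toLinearMap)

theorem evenPart_apply (x : OB s) : evenPart s x = (1 / 2 : ℂ) • (x + invol s x) := rfl

theorem oddPart_apply (x : OB s) : oddPart s x = (1 / 2 : ℂ) • (x - invol s x) := rfl

theorem invol_invol (x : OB s) : invol s (invol s x) = x := by
  induction x using OB.induction with
  | zero => simp
  | tmul z w =>
    rw [map_smul, map_smul, invol_gen, invol_gen]
    exact congrArg (fun w => z • gen w) (CliffordAlgebra.involute_involute w)
  | add a b ha hb => rw [map_add, map_add, ha, hb]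

theorem evenPart_mem (x : OB s) : evenPart s x ∈ gr s 0 := by
  rw [mem_gr, evenPart_apply, map_smul, map_add, invol_invol, add_comm]
  simp [sgn]

theorem oddPart_mem (x : OB s) : oddPart s x ∈ gr s 1 := by
  rw [mem_gr, oddPart_apply, map_smul, map_sub, invol_invol]
  simp [sgn, ← smul_neg]

theorem evenPart_even {x : OB s} (hx : x ∈ gr s 0) : evenPart s x = x := by
  rw [evenPart_apply, invol_even hx, ← two_smul ℂ x, smul_smul]
  norm_num

theorem evenPart_odd {x : OB s} (hx : x ∈ gr s 1) : evenPart s x = 0 := by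
  rw [evenPart_apply, invol_odd hx, add_neg_cancel, smul_zero]

theorem evenPart_add_oddPart (x : OB s) : evenPart s x + oddPart s x = x := by
  rw [evenPart_apply, oddPart_apply, ← smul_add, add_add_sub_cancel, ← two_smul ℂ x, smul_smul]
  norm_num

theorem evenPart_mul (x y : OB s) :
    evenPart s (x * y) = evenPart s x * evenPart s y + oddPart s x * oddPart s y := by
  have h1 : (1 : ZMod 2) + 1 = 0 := by decide
  have hee := mul_mem_gr (evenPart_mem x) (evenPart_mem y)
  have heo := mul_mem_gr (evenPart_mem x) (oddPart_mem y)
  have hoe := mul_mem_gr (oddPart_mem x) (evenPart_mem y)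
  have hoo := mul_mem_gr (oddPart_mem x) (oddPart_mem y)
  rw [add_zero] at hee hoe
  rw [zero_add] at heo
  rw [h1] at hoo
  conv_lhs => rw [← evenPart_add_oddPart x, ← evenPart_add_oddPart y]
  rw [add_mul, mul_add, mul_add, map_add, map_add, map_add, evenPart_even hee, evenPart_odd heo,
    evenPart_odd hoe, evenPart_even hoo, add_zero, zero_add]

theorem mul_odd_sq {α β : OB s} (hα : α ∈ gr s 1) (hβ : β ∈ gr s 1) :
    α * β * (α * β) = 0 := by
  rw [mul_assoc, ← mul_assoc β, odd_comm hβ hα, neg_mul, mul_assoc α β β, odd_sq hβ]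
  simp

/-- The nilpotent part of the even part of an element of `𝒪_B ⊗ ℂ`. -/
def soul (x : OB s) : Even s := ⟨evenPart s x, evenPart_mem x⟩ - algebraMap ℂ (Even s) (body s x)

theorem coe_soul (x : OB s) : (soul x : OB s) = evenPart s x - algebraMap ℂ (OB s) (body s x) :=
  rfl

/-- The even part of xy is x₀y₀ + x₁y₁. Subtracting the bodies splits the soul of xy into a multiple
of the soul of x, a multiple of the soul of y, and x₁y₁, whose square is zero. All three lie in the
commutative ring of even functions, where sums of nilpotents are nilpotent. -/
theorem isNilpotent_soul_mul {x y : OB s} (hx : IsNilpotent (soul x)) (hy : IsNilpotent (soul y)) :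
    IsNilpotent (soul (x * y)) := by
  have h : soul (x * y) = soul x * ⟨evenPart s y, evenPart_mem y⟩ +
      algebraMap ℂ (Even s) (body s x) * soul y +
        ⟨oddPart s x * oddPart s y, gr_two (mul_mem_gr (oddPart_mem x) (oddPart_mem y))⟩ := by
    apply Subtype.ext
    change (soul (x * y) : OB s) = soul x * evenPart s y +
      algebraMap ℂ (OB s) (body s x) * soul y + oddPart s x * oddPart s y
    rw [coe_soul, coe_soul, coe_soul, evenPart_mul, map_mul, map_mul, sub_mul, mul_sub]
    abel
  have h3 : IsNilpotent (⟨oddPart s x * oddPart s y,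
      gr_two (mul_mem_gr (oddPart_mem x) (oddPart_mem y))⟩ : Even s) :=
    ⟨2, by rw [pow_two]; exact Subtype.ext (mul_odd_sq (oddPart_mem x) (oddPart_mem y))⟩
  rw [h]
  refine (Commute.all _ _).isNilpotent_add ((Commute.all _ _).isNilpotent_add ?_ ?_) h3
  · exact (Commute.all _ _).isNilpotent_mul_right hx
  · exact (Commute.all _ _).isNilpotent_mul_left hy

theorem soul_add (x y : OB s) : soul (x + y) = soul x + soul y := by
  apply Subtype.ext
  change (soul (x + y) : OB s) = soul x + soul y
  rw [coe_soul, coe_soul, coe_soul, map_add, map_add, map_add]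
  abel

theorem soul_algebraMap (c : ℂ) : soul (algebraMap ℂ (OB s) c) = 0 := by
  apply Subtype.ext
  rw [coe_soul, AlgHom.commutes, evenPart_even ((Even s).algebraMap_mem c)]
  exact sub_self _

theorem soul_odd {x : OB s} (hx : x ∈ gr s 1) : soul x = 0 := by
  apply Subtype.ext
  rw [coe_soul, evenPart_odd hx, body_odd hx, map_zero, sub_zero]
  rfl

theorem gen_ι_mem (v : Fin s → ℝ) : (gen (ExteriorAlgebra.ι ℝ v) : OB s) ∈ gr s 1 := by
  have h := gen_mul v (1 : OB s)
  have h2 : grasInvol s (ExteriorAlgebra.ι ℝ v) = - ExteriorAlgebra.ι ℝ v :=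
    CliffordAlgebra.involute_ι v
  have h3 : (gen (- ExteriorAlgebra.ι ℝ v : Gras s) : OB s) = - gen (ExteriorAlgebra.ι ℝ v) :=
    TensorProduct.tmul_neg _ _
  rw [mem_gr, invol_gen, h2, h3]
  simp [sgn]

/-- Induction over the generation of the Grassmann algebra: the soul vanishes on scalars and on odd
generators, and nilpotency passes to sums and products. -/
theorem isNilpotent_soul (x : OB s) : IsNilpotent (soul x) := by
  have hg : ∀ w : Gras s, IsNilpotent (soul (gen w)) := by
    intro w
    induction w using ExteriorAlgebra.induction with
    | algebraMap r => rw [gen_algebraMap, soul_algebraMap]; exact IsNilpotent.zero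
    | ι v => rw [soul_odd (gen_ι_mem v)]; exact IsNilpotent.zero
    | mul a b ha hb => rw [gen_mul']; exact isNilpotent_soul_mul ha hb
    | add a b ha hb => rw [gen_add, soul_add]; exact (Commute.all _ _).isNilpotent_add ha hb
  induction x using OB.induction with
  | zero => rw [soul_odd (gr s 1).zero_mem]; exact IsNilpotent.zero
  | tmul z w =>
    rw [Algebra.smul_def]
    exact isNilpotent_soul_mul (by rw [soul_algebraMap]; exact IsNilpotent.zero) (hg w)
  | add a b ha hb => rw [soul_add]; exact (Commute.all _ _).isNilpotent_add ha hb

theorem isNilpotent_of_body_eq_zero {x : Even s} (hx : body s x = 0) : IsNilpotent x := by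
  have h : soul (x : OB s) = x := by
    apply Subtype.ext
    rw [coe_soul, hx, map_zero, sub_zero, evenPart_even x.2]
  exact h ▸ isNilpotent_soul (x : OB s)

/-- A solution of `e² + 2 k = 1` with `k² = 0` and reduction `1` is `1 - k`. -/
theorem eq_one_sub_of_sq {e k : Even s} (hk : k * k = 0) (he : e ^ 2 + 2 * k = 1)
    (hb : body s e = 1) : e = 1 - k := by
  have hkn : IsNilpotent k := ⟨2, by rw [pow_two, hk]⟩
  have hn : IsNilpotent (e - 1) := isNilpotent_of_body_eq_zero (by
    change body s ((e : OB s) - 1) = 0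
    rw [map_sub, hb, map_one, sub_self])
  have hm : IsNilpotent (e - 1 - k) := (Commute.all _ _).isNilpotent_sub hn hkn
  have h2 : IsUnit (2 : Even s) := by
    have := (IsUnit.mk0 (2 : ℂ) two_ne_zero).map (algebraMap ℂ (Even s))
    rwa [map_ofNat] at this
  -- This factor is e + 1 - k, and e² - (1 - k)² = (e + 1 - k)(e - (1 - k)) vanishes by the equation
  -- for e and k² = 0.
  have hu : IsUnit (2 + (e - 1 - k)) := hm.isUnit_add_left_of_commute h2 (Commute.all _ _)
  have h0 : (2 + (e - 1 - k)) * (e - (1 - k)) = 0 := by linear_combination he - hk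
  exact sub_eq_zero.mp ((hu.mul_right_eq_zero).mp h0)

end Nilpotent

/-! ### Explicit equations of `SC(ℙ^{1|1})` -/

section Equations

variable {s : ℕ}

/-- The equations of `SpO_ℂ(2|1)`, solved for the last column, on the component where the reduction
of the lower right entry is `1`. -/
structure SCEqs (M : Matrix (Fin 3) (Fin 3) (OB s)) : Prop where
  det : M 0 0 * M 1 1 - M 1 0 * M 0 1 = 1 + M 2 0 * M 2 1
  corner : M 2 2 = 1 - M 2 0 * M 2 1
  top : M 0 2 = M 0 1 * M 2 0 - M 0 0 * M 2 1
  bottom : M 1 2 = M 1 1 * M 2 0 - M 1 0 * M 2 1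

theorem mul_mul_odd_left {α β : OB s} (hα : α ∈ gr s 1) (hβ : β ∈ gr s 1) : α * β * α = 0 := by
  rw [mul_assoc, odd_comm hβ hα, mul_neg, ← mul_assoc, odd_sq hα, zero_mul, neg_zero]

theorem mul_mul_odd_right {α β : OB s} (hβ : β ∈ gr s 1) : α * β * β = 0 := by
  rw [mul_assoc, odd_sq hβ, mul_zero]

/-- Moving the even coefficients out leaves αβα and αββ, each containing the square of an odd
element. -/
theorem mul_odd_combination {α β a b : OB s} (hα : α ∈ gr s 1) (hβ : β ∈ gr s 1)
    (ha : a ∈ gr s 0) (hb : b ∈ gr s 0) : α * β * (a * α - b * β) = 0 := by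
  rw [mul_sub, ← mul_assoc, ← mul_assoc, even_comm ha, even_comm hb, mul_assoc a, mul_assoc b,
    mul_mul_odd_left hα hβ, mul_mul_odd_right hβ]
  simp

/-- The α² and β² terms drop out, and βα = -αβ turns the two cross terms into a determinant. This
computes γδ once the last column is solved for. -/
theorem odd_combination_mul {α β a b c d : OB s} (hα : α ∈ gr s 1) (hβ : β ∈ gr s 1)
    (hb : b ∈ gr s 0) (hd : d ∈ gr s 0) :
    (c * α - a * β) * (d * α - b * β) = (a * d - b * c) * (α * β) := by
  have h : ∀ x ξ y η : OB s, y ∈ gr s 0 → x * ξ * (y * η) = x * y * (ξ * η) := by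
    intro x ξ y η hy
    rw [mul_assoc, ← mul_assoc ξ, even_comm hy, mul_assoc, mul_assoc]
  rw [mul_sub, sub_mul, sub_mul, h _ _ _ _ hd, h _ _ _ _ hd, h _ _ _ _ hb, h _ _ _ _ hb,
    odd_sq hα, odd_sq hβ, odd_comm hβ hα, even_comm hb c]
  simp only [mul_zero, zero_sub, sub_zero, mul_neg, sub_mul, neg_neg]

theorem sCEqs_iff (M : SMat s) : SCEqs M.1 ↔ SpEqs M.1 ∧ body s (M.1 2 2) = 1 := by
  have hα := o20 M
  have hβ := o21 M
  have hk := mul_odd_sq hα hβ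
  have hz := mul_odd_combination hα hβ (e01 M) (e00 M)
  have hw := mul_odd_combination hα hβ (e11 M) (e10 M)
  have hzw := odd_combination_mul (a := M.1 0 0) (c := M.1 0 1) hα hβ (e10 M) (e11 M)
  constructor
  · intro h
    refine ⟨⟨?_, ?_, ?_, ?_⟩, ?_⟩
    · rw [h.top, h.bottom, hzw, h.det, add_mul, hk]
      simp
    · rw [h.corner, pow_two, mul_sub, sub_mul, sub_mul, hk]
      simp only [mul_one, one_mul, two_mul]
      abel
    · rw [h.top, h.corner, sub_mul, hz, one_mul, sub_zero]
    · rw [h.bottom, h.corner, sub_mul, hw, one_mul, sub_zero]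
    · rw [h.corner, map_sub, map_mul, body_odd hα]
      simp
  · rintro ⟨h, hb⟩
    have hcorner : M.1 2 2 = 1 - M.1 2 0 * M.1 2 1 :=
      congrArg Subtype.val (eq_one_sub_of_sq (e := ⟨M.1 2 2, e22 M⟩)
        (k := ⟨M.1 2 0 * M.1 2 1, gr_two (mul_mem_gr hα hβ)⟩) (Subtype.ext hk)
        (Subtype.ext h.h2) hb)
    -- With e = 1 - k the inverse is 1 + k, so z = e y gives y = (1 + k) z, which is z when k kills
    -- z.
    have hsolve : ∀ z y : OB s, M.1 2 0 * M.1 2 1 * z = 0 → z = M.1 2 2 * y → y = z := by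
      intro z y hz hy
      have : (1 + M.1 2 0 * M.1 2 1) * z = y := by
        rw [hy, hcorner, ← mul_assoc, add_mul, mul_sub, one_mul, mul_sub, hk]
        simp
      rw [← this, add_mul, hz, one_mul, add_zero]
    have htop := hsolve _ _ hz h.h3
    have hbottom := hsolve _ _ hw h.h4
    refine ⟨?_, hcorner, htop, hbottom⟩
    have h1 := h.h1
    rw [htop, hbottom, hzw] at h1
    -- At this point (ad - bc)(1 - k) = 1; multiplying by 1 + k isolates the determinant.
    have h2 := congrArg (· * (1 + M.1 2 0 * M.1 2 1)) h1
    simp only [sub_mul, mul_add, mul_one, one_mul] at h2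
    rw [← h2]
    have h3 : ∀ x : OB s, x * (M.1 2 0 * M.1 2 1) * (M.1 2 0 * M.1 2 1) = 0 := fun x => by
      rw [mul_assoc, hk, mul_zero]
    simp only [h3]
    abel

theorem SC.sCEqs (L : SC s) : SCEqs L.1.1.1 := (sCEqs_iff L.1.1).mpr L.2

theorem adj_mem (M : SMat s) : adj M.1 ∈ SMat s := by
  have h2 : (1 : ZMod 2) + 1 = 0 := by decide
  intro i j
  fin_cases i <;> fin_cases j <;> simp [adj, par3, h2, e00 M, e01 M, e10 M, e11 M, e22 M, o02 M,
    o12 M, o20 M, o21 M]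

theorem isUnit_of_spEqs {M : SMat s} (h : SpEqs M.1) : IsUnit M := by
  have h0 := (spEqs_iff M).mp h
  -- The entries do not commute, so determinants are unavailable. A one-sided inverse of a matrix
  -- over this ring is two-sided because the ring, being finite-dimensional, is Noetherian.
  have : IsNoetherianRing (OB s) := isNoetherian_of_tower ℂ inferInstance
  have h1 : adj M.1 * M.1 = 1 := mul_eq_one_symm h0
  exact ⟨⟨M, ⟨_, adj_mem M⟩, Subtype.ext h0, Subtype.ext h1⟩, rfl⟩

/-- The point of `SC(ℙ^{1|1})` with a given supermatrix. -/
theorem SCEqs.exists_point {M : SMat s} (h : SCEqs M.1) : ∃ L : SC s, L.1.1 = M := by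
  have h' := (sCEqs_iff M).mp h
  obtain ⟨u, hu⟩ := isUnit_of_spEqs h'.1
  subst hu
  exact ⟨⟨u, h'⟩, rfl⟩

end Equations

/-! ### The factorisation -/

section Factor

variable {s : ℕ}

theorem SC.ext_mat {L N : SC s} (h : ∀ i j, L.1.1.1 i j = N.1.1.1 i j) : L = N :=
  SC.mat_injective s (Matrix.ext h)

theorem SC.coe_mul (L N : SC s) : (L * N).1.1.1 = L.1.1.1 * N.1.1.1 := rfl

theorem toSC_injective : Function.Injective (toSC s) := by
  intro l m h
  have h' : ∀ i j, blockMat l.1 i j = blockMat m.1 i j := fun i j =>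
    congrArg (fun L : SC s => L.1.1.1 i j) h
  ext i j
  fin_cases i <;> fin_cases j
  · exact h' 0 0
  · exact h' 0 1
  · exact h' 1 0
  · exact h' 1 1

/-- The odd coordinates of a point of `SC(ℙ^{1|1})`. -/
def SC.odd (L : SC s) : SVec oddPar s := fun i => ⟨L.1.1.1 2 i.castSucc, by
  fin_cases i
  exacts [o20 L.1.1, o21 L.1.1]⟩

theorem SC.odd_toSC_mul_susy (l : SL2 s) (v : SVec oddPar s) : SC.odd (toSC s l * susy s v) = v := by
  funext i
  apply Subtype.ext
  fin_cases i
  · change ((blockMat l.1 * susyMat (v 0 : OB s) (v 1)) 2 0 : OB s) = v 0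
    simp [blockMat, susyMat, Matrix.mul_apply, Fin.sum_univ_three]
  · change ((blockMat l.1 * susyMat (v 0 : OB s) (v 1)) 2 1 : OB s) = v 1
    simp [blockMat, susyMat, Matrix.mul_apply, Fin.sum_univ_three]

/-- The two by two matrix whose product with the supersymmetry matrix has the same upper left
block as a given even supermatrix. -/
def slBlock (M : SMat s) : Matrix (Fin 2) (Fin 2) (Even s) :=
  (1 - (1 / 2 : ℂ) • (⟨M.1 2 0 * M.1 2 1, gr_two (mul_mem_gr (o20 M) (o21 M))⟩ : Even s)) •
    !![⟨M.1 0 0, e00 M⟩, ⟨M.1 0 1, e01 M⟩; ⟨M.1 1 0, e10 M⟩, ⟨M.1 1 1, e11 M⟩]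

theorem half_smul_mul_self {k : OB s} (hk : k * k = 0) :
    (1 - (1 / 2 : ℂ) • k) * (1 + (1 / 2 : ℂ) • k) = 1 := by
  rw [sub_mul, mul_add, mul_add, smul_mul_smul_comm, hk]
  simp

/-- Scaling a two by two block by 1 - k/2 multiplies its determinant 1 + k by (1 - k/2)² = 1 - k. -/
theorem slBlock_det {M : SMat s} (h : SCEqs M.1) : (slBlock M).det = 1 := by
  rw [slBlock, Matrix.det_smul, Matrix.det_fin_two]
  set k : Even s := ⟨M.1 2 0 * M.1 2 1, gr_two (mul_mem_gr (o20 M) (o21 M))⟩ with hkdef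
  have hk : k * k = 0 := Subtype.ext (mul_odd_sq (o20 M) (o21 M))
  have hh : (1 / 2 : ℂ) • k + (1 / 2 : ℂ) • k = k := by rw [← add_smul]; norm_num
  have hh2 : (1 / 2 : ℂ) • k * (1 / 2 : ℂ) • k = 0 := by
    rw [smul_mul_smul_comm, hk, smul_zero]
  have hd : (⟨M.1 0 0, e00 M⟩ : Even s) * ⟨M.1 1 1, e11 M⟩ - ⟨M.1 1 0, e10 M⟩ * ⟨M.1 0 1, e01 M⟩ =
    1 + k := Subtype.ext h.det
  simp only [Matrix.of_apply, Matrix.cons_val', Matrix.cons_val_zero, Matrix.cons_val_one,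
    Matrix.cons_val_fin_one, Fintype.card_fin]
  rw [mul_comm (⟨M.1 0 1, e01 M⟩ : Even s), hd]
  -- Treating k/2 as a ring variable h leaves a polynomial identity modulo h + h = k, h² = 0 and k²
  -- = 0.
  generalize (1 / 2 : ℂ) • k = h at *
  linear_combination (-1 - k) * hh + (1 + k) * hh2 - hk

/-- The `SL_ℂ(2)`-component of a point of `SC(ℙ^{1|1})`. -/
def SC.even (L : SC s) : SL2 s := ⟨slBlock L.1.1, slBlock_det (SC.sCEqs L)⟩

/-- In the upper left block the factors 1 - k/2 and 1 + k/2 cancel. In the last column 1 - k/2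
multiplies an even combination of α and β, on which it acts as the identity, and the result is the
solved form of γ and δ. The last row is that of S(α, β), with corner 1 - k. -/
theorem SC.toSC_even_mul_susy_odd (L : SC s) : toSC s (SC.even L) * susy s (SC.odd L) = L := by
  have h := (SC.sCEqs L)
  have hα := o20 L.1.1
  have hβ := o21 L.1.1
  have hk := mul_odd_sq hα hβ
  have hke : L.1.1.1 2 0 * L.1.1.1 2 1 ∈ gr s 0 := gr_two (mul_mem_gr hα hβ)
  have hd : ∀ x ∈ gr s 0,
      (1 - (1 / 2 : ℂ) • (L.1.1.1 2 0 * L.1.1.1 2 1)) * x *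
        (1 + (1 / 2 : ℂ) • (L.1.1.1 2 0 * L.1.1.1 2 1)) = x := by
    intro x hx
    rw [even_comm hx, mul_assoc, half_smul_mul_self hk, mul_one]
  have ho : ∀ x y : OB s, L.1.1.1 2 0 * L.1.1.1 2 1 * (y * L.1.1.1 2 0 - x * L.1.1.1 2 1) = 0 →
      (1 - (1 / 2 : ℂ) • (L.1.1.1 2 0 * L.1.1.1 2 1)) * x * -L.1.1.1 2 1 +
        (1 - (1 / 2 : ℂ) • (L.1.1.1 2 0 * L.1.1.1 2 1)) * y * L.1.1.1 2 0 =
      y * L.1.1.1 2 0 - x * L.1.1.1 2 1 := by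
    intro x y h0
    rw [mul_assoc, mul_assoc, ← mul_add, mul_neg, neg_add_eq_sub, sub_mul, one_mul,
      smul_mul_assoc, h0, smul_zero, sub_zero]
  have hz := mul_odd_combination hα hβ (e01 L.1.1) (e00 L.1.1)
  have hw := mul_odd_combination hα hβ (e11 L.1.1) (e10 L.1.1)
  have e00' := e00 L.1.1
  have e01' := e01 L.1.1
  have e10' := e10 L.1.1
  have e11' := e11 L.1.1
  refine SC.ext_mat fun i j => ?_
  change (blockMat (slBlock L.1.1) * susyMat (L.1.1.1 2 0) (L.1.1.1 2 1)) i j = L.1.1.1 i j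
  rw [Matrix.mul_apply, Fin.sum_univ_three]
  fin_cases i <;> fin_cases j <;>
    simp only [blockMat, slBlock, susyMat, Matrix.of_apply, Matrix.cons_val', Matrix.cons_val_zero,
      Matrix.cons_val_one, Matrix.cons_val, Fin.zero_eta, Fin.mk_one, Fin.reduceFinMk, Fin.isValue,
      Matrix.smul_apply, smul_eq_mul, zero_mul, mul_zero, add_zero, zero_add, one_mul,
      MulMemClass.coe_mul]
  · exact hd _ e00'
  · exact hd _ e01'
  · rw [h.top]; exact ho _ _ hz
  · exact hd _ e10'
  · exact hd _ e11'
  · rw [h.bottom]; exact ho _ _ hw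
  · exact h.corner.symm

/-- Writing L as ι(l') S(v) makes both sides the odd row of a product of this shape, namely v. -/
theorem SC.odd_toSC_mul (l : SL2 s) (L : SC s) : SC.odd (toSC s l * L) = SC.odd L := by
  rw [← (SC.toSC_even_mul_susy_odd L), ← mul_assoc, ← map_mul, odd_toSC_mul_susy, odd_toSC_mul_susy]

/-- Refactoring the product returns the same odd parameters, so the supersymmetry factor cancels on
the right and ι is injective. -/
theorem SC.even_toSC_mul_susy (l : SL2 s) (v : SVec oddPar s) :
    SC.even (toSC s l * susy s v) = l := by
  have h := SC.toSC_even_mul_susy_odd (toSC s l * susy s v)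
  rw [odd_toSC_mul_susy] at h
  exact toSC_injective (mul_right_cancel h)

theorem SC.odd_eq_iff (L N : SC s) : SC.odd L = SC.odd N ↔ ∃ l : SL2 s, toSC s l * L = N := by
  constructor
  · intro h
    -- When the odd rows agree, both points are SL₂-multiples of the same supersymmetry
    -- transformation; the quotient of the two multipliers carries one point to the other.
    refine ⟨(SC.even N) * (SC.even L)⁻¹, ?_⟩
    calc toSC s (SC.even N * (SC.even L)⁻¹) * L
        = toSC s (SC.even N * (SC.even L)⁻¹) * (toSC s (SC.even L) * susy s (SC.odd L)) := by
          rw [SC.toSC_even_mul_susy_odd L]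
      _ = N := by
          rw [← mul_assoc, ← map_mul, inv_mul_cancel_right, h, SC.toSC_even_mul_susy_odd]
  · rintro ⟨l, rfl⟩
    rw [odd_toSC_mul]

theorem susy_odd (v : SVec oddPar s) : SC.odd (susy s v) = v := by
  have h := SC.odd_toSC_mul_susy 1 v
  rwa [map_one, one_mul] at h

end Factor

/-! ### Superholomorphic families of matrices -/

section Matrices

variable {ι : Type} [Fintype ι] {p : ι → ZMod 2}

/-- The even supermatrix with given entries. -/
def toSMat {s : ℕ} (y : SVec matPar s) : SMat s := ⟨fun i j => y (i, j), fun i j => (y (i, j)).2⟩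

/-- The entries of an even supermatrix. -/
def smatCoord {s : ℕ} (M : SMat s) : SVec matPar s := fun ij => ⟨M.1 ij.1 ij.2, M.2 ij.1 ij.2⟩

/-- The two by two matrix of even functions with given entries. -/
def toEvenMat {s : ℕ} (y : SVec (fun _ : Fin 2 × Fin 2 => 0) s) : Matrix (Fin 2) (Fin 2) (Even s) :=
  fun i j => ⟨y (i, j), (y (i, j)).2⟩

/-- The entries of a two by two matrix of even functions. -/
def evenMatCoord {s : ℕ} (m : Matrix (Fin 2) (Fin 2) (Even s)) :
    SVec (fun _ : Fin 2 × Fin 2 => 0) s := fun ij => ⟨m ij.1 ij.2, (m ij.1 ij.2).2⟩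

/-- The even supermatrix of a supersymmetry transformation. -/
def susySMat {s : ℕ} (v : SVec oddPar s) : SMat s :=
  ⟨susyMat (v 0) (v 1), susyMat_mem (v 0).2 (v 1).2⟩

/-- A family of even supermatrices with superholomorphic entries. -/
def SHolSMat (M : ∀ s, SVec p s → SMat s) : Prop := ∀ i j, SHolFun (fun s x => (M s x).1 i j)

/-- A family of two by two matrices of even functions with superholomorphic entries. -/
def SHolEvenMat (m : ∀ s, SVec p s → Matrix (Fin 2) (Fin 2) (Even s)) : Prop :=
  ∀ i j, SHolFun (fun s x => (m s x i j : OB s))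

theorem SHolSMat.mul {M N : ∀ s, SVec p s → SMat s} (hM : SHolSMat M) (hN : SHolSMat N) :
    SHolSMat (fun s x => M s x * N s x) := fun i j => by
  change SHolFun (fun s x => ((M s x).1 * (N s x).1) i j)
  simp only [Matrix.mul_apply]
  exact SHolFun.sum _ fun k => (hM i k).mul (hN k j)

theorem SHolEvenMat.mul {m n : ∀ s, SVec p s → Matrix (Fin 2) (Fin 2) (Even s)}
    (hm : SHolEvenMat m) (hn : SHolEvenMat n) : SHolEvenMat (fun s x => m s x * n s x) :=
  fun i j => by
    simp only [Matrix.mul_apply, Fin.sum_univ_two]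
    exact ((hm i 0).mul (hn 0 j)).add ((hm i 1).mul (hn 1 j))

theorem SHolEvenMat.adjugate {m : ∀ s, SVec p s → Matrix (Fin 2) (Fin 2) (Even s)}
    (hm : SHolEvenMat m) : SHolEvenMat (fun s x => (m s x).adjugate) := fun i j => by
  simp only [Matrix.adjugate_fin_two]
  fin_cases i <;> fin_cases j
  exacts [hm 1 1, (hm 0 1).neg, (hm 1 0).neg, hm 0 0]

theorem SHolEvenMat.block {m : ∀ s, SVec p s → Matrix (Fin 2) (Fin 2) (Even s)}
    (hm : SHolEvenMat m) : SHolSMat (fun s x => blockHom s (m s x)) := fun i j => by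
  change SHolFun (fun s x => blockMat (m s x) i j)
  fin_cases i <;> fin_cases j
  exacts [hm 0 0, hm 0 1, .zero, hm 1 0, hm 1 1, .zero, .zero, .zero, .one]

theorem SHolSMat.adj {M : ∀ s, SVec p s → SMat s} (hM : SHolSMat M) :
    SHolSMat (fun s x => ⟨adj (M s x).1, adj_mem _⟩) := fun i j => by
  fin_cases i <;> fin_cases j
  exacts [hM 1 1, (hM 0 1).neg, hM 2 1, (hM 1 0).neg, hM 0 0, (hM 2 0).neg, (hM 1 2).neg, hM 0 2,
    hM 2 2]

theorem SHolSMat.slBlock {M : ∀ s, SVec p s → SMat s} (hM : SHolSMat M) :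
    SHolEvenMat (fun s x => slBlock (M s x)) := fun i j => by
  have h := SHolFun.one.sub (((hM 2 0).mul (hM 2 1)).smul (1 / 2))
  fin_cases i <;> fin_cases j
  exacts [h.mul (hM 0 0), h.mul (hM 0 1), h.mul (hM 1 0), h.mul (hM 1 1)]

theorem sHolSMat_susy {v : ∀ s, SVec p s → SVec oddPar s}
    (hv : ∀ i, SHolFun (fun s x => (v s x i : OB s))) :
    SHolSMat (fun s x => susySMat (v s x)) := fun i j => by
  have h := (hv 0).mul (hv 1)
  have hd := SHolFun.one.add (h.smul (1 / 2))
  fin_cases i <;> fin_cases j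
  exacts [hd, .zero, (hv 1).neg, .zero, hd, hv 0, hv 0, hv 1, SHolFun.one.sub h]

theorem sHolSMat_toSMat : SHolSMat (fun s (y : SVec matPar s) => toSMat y) := fun i j =>
  .coord (i, j)

theorem sHolEvenMat_toEvenMat :
    SHolEvenMat (fun s (y : SVec (fun _ : Fin 2 × Fin 2 => 0) s) => toEvenMat y) := fun i j =>
  .coord (i, j)

end Matrices

/-! ### The groups are super Lie groups -/

theorem isSHol_SL2_mul : IsSHol (prodSpace SL2Space SL2Space) SL2Space (fun _ x => x.1 * x.2) := by
  refine isSHol_of_global (g := fun s x => evenMatCoord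
    (toEvenMat (fun ij => x (Sum.inl ij)) * toEvenMat (fun ij => x (Sum.inr ij)))) ?_ ?_
  · intro ij
    have h1 : SHolEvenMat (p := (prodSpace SL2Space SL2Space).par)
        (fun s x => toEvenMat (fun ij => x (Sum.inl ij))) := fun i j => .coord (Sum.inl (i, j))
    have h2 : SHolEvenMat (p := (prodSpace SL2Space SL2Space).par)
        (fun s x => toEvenMat (fun ij => x (Sum.inr ij))) := fun i j => .coord (Sum.inr (i, j))
    exact (h1.mul h2) ij.1 ij.2
  · rintro s ⟨l, m⟩ ⟨i, j⟩
    rfl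

theorem isSHol_SL2_inv : IsSHol SL2Space SL2Space (fun _ x => x⁻¹) := by
  refine isSHol_of_global (g := fun s x => evenMatCoord (toEvenMat x).adjugate) ?_ ?_
  · intro ij
    exact sHolEvenMat_toEvenMat.adjugate ij.1 ij.2
  · rintro s l ⟨i, j⟩
    rfl

theorem isSHol_SC_mul : IsSHol (prodSpace SCSpace SCSpace) SCSpace (fun _ x => x.1 * x.2) := by
  refine isSHol_of_global (g := fun s x => smatCoord
    (toSMat (fun ij => x (Sum.inl ij)) * toSMat (fun ij => x (Sum.inr ij)))) ?_ ?_
  · intro ij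
    have h1 : SHolSMat (p := (prodSpace SCSpace SCSpace).par)
        (fun s x => toSMat (fun ij => x (Sum.inl ij))) := fun i j => .coord (Sum.inl (i, j))
    have h2 : SHolSMat (p := (prodSpace SCSpace SCSpace).par)
        (fun s x => toSMat (fun ij => x (Sum.inr ij))) := fun i j => .coord (Sum.inr (i, j))
    exact (h1.mul h2) ij.1 ij.2
  · rintro s ⟨L, N⟩ ⟨i, j⟩
    rfl

/-- On the group the inverse is `adj`, whose entries are signed entries of the matrix, so inversion
is the restriction of a linear map. -/
theorem isSHol_SC_inv : IsSHol SCSpace SCSpace (fun _ x => x⁻¹) := by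
  refine isSHol_of_global (g := fun s x => smatCoord ⟨adj (toSMat x).1, adj_mem _⟩) ?_ ?_
  · intro ij
    exact sHolSMat_toSMat.adj ij.1 ij.2
  · rintro s (L : SC s) ⟨i, j⟩
    exact congrFun (congrFun (inv_eq_adj L.1 L.2.1) i) j

/-! ### Defining functions, submersivity and dimensions -/

section Manifolds

set_option linter.unusedSectionVars false

variable {ι : Type} [Fintype ι] {p : ι → ZMod 2}

theorem sHolFun_coord_mul (i j : ι) : SHolFun (fun s (x : SVec p s) => (x i : OB s) * x j) :=
  (SHolFun.coord i).mul (.coord j)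

theorem fderiv_coord_mul (i j : ι) (s : ℕ) (x v : SVec p s) :
    fderiv ℂ (fun x : SVec p s => (x i : OB s) * x j) x v = x i * v j + v i * x j := by
  rw [SHolFun.fderiv_mul (SHolFun.coord i) (SHolFun.coord j) s x v, fderiv_coord, fderiv_coord]

theorem fderiv_one (s : ℕ) (x v : SVec p s) :
    fderiv ℂ (fun _ : SVec p s => (1 : OB s)) x v = 0 := by
  simp

theorem surjective_fderiv_of_components {κ : Type} [Fintype κ] {q : κ → ZMod 2}
    {F : ∀ s, SVec p s → SVec q s} (hF : ∀ j, SHolFun (fun s x => (F s x j : OB s))) {s : ℕ}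
    {x : SVec p s}
    (h : ∀ w : SVec q s, ∃ v, ∀ j, fderiv ℂ (fun x => (F s x j : OB s)) x v = w j) :
    Function.Surjective (fderiv ℂ (F s) x) := by
  intro w
  obtain ⟨v, hv⟩ := h w
  refine ⟨v, funext fun j => Subtype.ext ?_⟩
  rw [fderiv_component (differentiableAt_of_components fun j => (hF j).differentiable s x), hv]

/-- The defining function of `SL_ℂ(2)` in `ℂ^{4|0}`. -/
def slEq (s : ℕ) (y : SVec (fun _ : Fin 2 × Fin 2 => 0) s) : SVec (fun _ : Fin 1 => 0) s :=
  fun _ => ⟨((toEvenMat y).det - 1 : Even s), ((toEvenMat y).det - 1).2⟩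

theorem slEq_apply (s : ℕ) (y : SVec (fun _ : Fin 2 × Fin 2 => 0) s) (j : Fin 1) :
    (slEq s y j : OB s) = y (0, 0) * y (1, 1) - y (0, 1) * y (1, 0) - 1 := by
  change (((toEvenMat y).det - 1 : Even s) : OB s) = _
  rw [Matrix.det_fin_two]
  rfl

theorem sHolFun_slEq (j : Fin 1) : SHolFun (fun s y => (slEq s y j : OB s)) := by
  simp only [slEq_apply]
  exact (((SHolFun.coord _).mul (.coord _)).sub ((SHolFun.coord _).mul (.coord _))).sub .one

theorem fderiv_slEq (s : ℕ) (x v : SVec (fun _ : Fin 2 × Fin 2 => 0) s) (j : Fin 1) :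
    fderiv ℂ (fun x => (slEq s x j : OB s)) x v =
      x (0, 0) * v (1, 1) + v (0, 0) * x (1, 1) -
        (x (0, 1) * v (1, 0) + v (0, 1) * x (1, 0)) := by
  have hm := fun i j => sHolFun_coord_mul (p := fun _ : Fin 2 × Fin 2 => 0) i j
  simp only [slEq_apply]
  rw [((hm (0, 0) (1, 1)).sub (hm (0, 1) (1, 0))).fderiv_sub .one,
    (hm (0, 0) (1, 1)).fderiv_sub (hm (0, 1) (1, 0)), fderiv_coord_mul, fderiv_coord_mul,
    fderiv_one, sub_zero]

theorem surjective_fderiv_slEq {s : ℕ} {x : SVec (fun _ : Fin 2 × Fin 2 => 0) s}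
    (hd : (x (0, 0) : OB s) * x (1, 1) - x (0, 1) * x (1, 0) = 1) :
    Function.Surjective (fderiv ℂ (slEq s) x) := by
  refine surjective_fderiv_of_components sHolFun_slEq fun w => ?_
  have ht : (1 / 2 : ℂ) • (w 0 : OB s) ∈ gr s 0 := (gr s 0).smul_mem _ (w 0).2
  -- The Euler direction: the determinant is quadratic, so along t x its derivative is 2t det x =
  -- 2t, and t = w/2 gives w.
  refine ⟨SVec.evenSMul ⟨_, ht⟩ x, fun j => ?_⟩
  rw [fderiv_slEq, Subsingleton.elim j 0]
  simp only [SVec.evenSMul]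
  have hc : ∀ a b : OB s, a * ((1 / 2 : ℂ) • (w 0 : OB s) * b) +
      (1 / 2 : ℂ) • (w 0 : OB s) * a * b = w 0 * (a * b) := by
    intro a b
    rw [← mul_assoc, even_comm ht a, ← add_mul, ← add_mul, ← add_smul, mul_assoc]
    norm_num
  rw [hc, hc, ← mul_sub, hd, mul_one]

theorem isSupermanifold_SL2 : IsSupermanifold SL2Space 3 0 := by
  intro s₀ x₀
  refine ⟨Set.univ, isOpen_univ, Set.mem_univ _, 1, fun _ => 0, slEq,
    sHolOn_of_components sHolFun_slEq _, ?_, ?_, ?_, ?_⟩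
  · intro s y _
    have h0 : slEq s y = 0 ↔ (toEvenMat y).det = 1 := by
      rw [← sub_eq_zero (a := (toEvenMat y).det)]
      exact ⟨fun h => Subtype.ext (congrArg Subtype.val (congrFun h 0)), fun h => funext fun _ =>
        Subtype.ext (congrArg Subtype.val h)⟩
    rw [h0]
    refine ⟨?_, fun h => ⟨⟨toEvenMat y, h⟩, rfl⟩⟩
    rintro ⟨l, rfl⟩
    exact Matrix.SpecialLinearGroup.det_coe l
  · intro s l _
    exact surjective_fderiv_slEq
      (congrArg Subtype.val ((Matrix.det_fin_two l.1).symm.trans l.2))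
  · change 3 + Nat.card {j : Fin 1 // (0 : ZMod 2) = 0} =
      Nat.card {i : Fin 2 × Fin 2 // (0 : ZMod 2) = 0}
    rw [Nat.card_eq_fintype_card, Nat.card_eq_fintype_card]
    rfl
  · change 0 + Nat.card {j : Fin 1 // (0 : ZMod 2) = 1} =
      Nat.card {i : Fin 2 × Fin 2 // (0 : ZMod 2) = 1}
    rw [Nat.card_eq_fintype_card, Nat.card_eq_fintype_card]
    rfl

/-! ### The zero locus of the solved equations in the space of supermatrices -/

/-- The parities of the defining equations of `SC(ℙ^{1|1})`. -/
def scPar : Fin 4 → ZMod 2 := ![0, 0, 1, 1]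

/-- The differences of the two sides of the explicit equations of `SC(ℙ^{1|1})`. -/
def scDefect {s : ℕ} (M : Matrix (Fin 3) (Fin 3) (OB s)) : Fin 4 → OB s :=
  ![M 0 0 * M 1 1 - M 1 0 * M 0 1 - (1 + M 2 0 * M 2 1), M 2 2 - (1 - M 2 0 * M 2 1),
    M 0 2 - (M 0 1 * M 2 0 - M 0 0 * M 2 1), M 1 2 - (M 1 1 * M 2 0 - M 1 0 * M 2 1)]

theorem even_mul_odd {s : ℕ} {x y : OB s} (hx : x ∈ gr s 0) (hy : y ∈ gr s 1) :
    x * y ∈ gr s 1 := by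
  have := mul_mem_gr hx hy
  rwa [zero_add] at this

theorem scDefect_mem {s : ℕ} (M : SMat s) (j : Fin 4) : scDefect M.1 j ∈ gr s (scPar j) := by
  have hk := gr_two (mul_mem_gr (o20 M) (o21 M))
  have h1 := one_mem_gr s
  fin_cases j
  · exact (gr s 0).sub_mem ((gr s 0).sub_mem ((Even s).mul_mem (e00 M) (e11 M))
      ((Even s).mul_mem (e10 M) (e01 M))) ((gr s 0).add_mem h1 hk)
  · exact (gr s 0).sub_mem (e22 M) ((gr s 0).sub_mem h1 hk)
  · exact (gr s 1).sub_mem (o02 M) ((gr s 1).sub_mem (even_mul_odd (e01 M) (o20 M))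
      (even_mul_odd (e00 M) (o21 M)))
  · exact (gr s 1).sub_mem (o12 M) ((gr s 1).sub_mem (even_mul_odd (e11 M) (o20 M))
      (even_mul_odd (e10 M) (o21 M)))

/-- The defining function of `SC(ℙ^{1|1})` in `ℂ^{5|4}`. -/
def scEq (s : ℕ) (y : SVec matPar s) : SVec scPar s :=
  fun j => ⟨scDefect (toSMat y).1 j, scDefect_mem _ j⟩

theorem scEq_eq_zero_iff {s : ℕ} (y : SVec matPar s) : scEq s y = 0 ↔ SCEqs (toSMat y).1 := by
  constructor
  · intro h
    have h' : ∀ j, scDefect (toSMat y).1 j = 0 := fun j => congrArg Subtype.val (congrFun h j)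
    exact ⟨sub_eq_zero.mp (h' 0), sub_eq_zero.mp (h' 1), sub_eq_zero.mp (h' 2),
      sub_eq_zero.mp (h' 3)⟩
  · intro h
    funext j
    apply Subtype.ext
    fin_cases j
    exacts [sub_eq_zero.mpr h.det, sub_eq_zero.mpr h.corner, sub_eq_zero.mpr h.top,
      sub_eq_zero.mpr h.bottom]

theorem sHolFun_scEq (j : Fin 4) : SHolFun (fun s y => (scEq s y j : OB s)) := by
  have hm := fun i j => sHolFun_coord_mul (p := matPar) i j
  fin_cases j
  · exact ((hm (0, 0) (1, 1)).sub (hm (1, 0) (0, 1))).sub (SHolFun.one.add (hm (2, 0) (2, 1)))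
  · exact (SHolFun.coord (2, 2)).sub (SHolFun.one.sub (hm (2, 0) (2, 1)))
  · exact (SHolFun.coord (0, 2)).sub ((hm (0, 1) (2, 0)).sub (hm (0, 0) (2, 1)))
  · exact (SHolFun.coord (1, 2)).sub ((hm (1, 1) (2, 0)).sub (hm (1, 0) (2, 1)))

theorem fderiv_scEq_det (s : ℕ) (x v : SVec matPar s) :
    fderiv ℂ (fun x => (scEq s x 0 : OB s)) x v =
      x (0, 0) * v (1, 1) + v (0, 0) * x (1, 1) - (x (1, 0) * v (0, 1) + v (1, 0) * x (0, 1)) -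
        (x (2, 0) * v (2, 1) + v (2, 0) * x (2, 1)) := by
  have hm := fun i j => sHolFun_coord_mul (p := matPar) i j
  change fderiv ℂ (fun x : SVec matPar s => (x (0, 0) : OB s) * x (1, 1) - x (1, 0) * x (0, 1) -
    (1 + x (2, 0) * x (2, 1))) x v = _
  rw [((hm (0, 0) (1, 1)).sub (hm (1, 0) (0, 1))).fderiv_sub (SHolFun.one.add (hm (2, 0) (2, 1))),
    (hm (0, 0) (1, 1)).fderiv_sub (hm (1, 0) (0, 1)), SHolFun.one.fderiv_add (hm (2, 0) (2, 1)),
    fderiv_coord_mul, fderiv_coord_mul, fderiv_coord_mul, fderiv_one, zero_add]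

theorem fderiv_scEq_corner (s : ℕ) (x v : SVec matPar s) :
    fderiv ℂ (fun x => (scEq s x 1 : OB s)) x v =
      v (2, 2) + (x (2, 0) * v (2, 1) + v (2, 0) * x (2, 1)) := by
  have hm := fun i j => sHolFun_coord_mul (p := matPar) i j
  change fderiv ℂ (fun x : SVec matPar s => (x (2, 2) : OB s) - (1 - x (2, 0) * x (2, 1))) x v = _
  rw [(SHolFun.coord (2, 2)).fderiv_sub (SHolFun.one.sub (hm (2, 0) (2, 1))),
    SHolFun.one.fderiv_sub (hm (2, 0) (2, 1)), fderiv_coord, fderiv_coord_mul, fderiv_one,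
    zero_sub, sub_neg_eq_add]

theorem fderiv_column_eq (s : ℕ) (x v : SVec matPar s) (i j k l m : Fin 3 × Fin 3) :
    fderiv ℂ (fun x : SVec matPar s => (x i : OB s) - (x j * x k - x l * x m)) x v =
      v i - (x j * v k + v j * x k - (x l * v m + v l * x m)) := by
  have hm := fun i j => sHolFun_coord_mul (p := matPar) i j
  rw [(SHolFun.coord i).fderiv_sub ((hm j k).sub (hm l m)), (hm j k).fderiv_sub (hm l m),
    fderiv_coord, fderiv_coord_mul, fderiv_coord_mul]

/-- A tangent vector on which the differential of `scEq` takes a prescribed value. -/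
def scLift {s : ℕ} (x : SVec matPar s) (w : SVec scPar s) : Matrix (Fin 3) (Fin 3) (OB s) :=
  let t : OB s := (1 / 2 : ℂ) • (w 0 : OB s) * (1 - x (2, 0) * x (2, 1))
  !![t * x (0, 0), t * x (0, 1), w 2 + (t * x (0, 1) * x (2, 0) - t * x (0, 0) * x (2, 1));
     t * x (1, 0), t * x (1, 1), w 3 + (t * x (1, 1) * x (2, 0) - t * x (1, 0) * x (2, 1));
     0, 0, w 1]

theorem half_smul_mul_mem {s : ℕ} (x : SVec matPar s) (w : SVec scPar s) :
    (1 / 2 : ℂ) • (w 0 : OB s) * (1 - x (2, 0) * x (2, 1)) ∈ gr s 0 :=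
  (Even s).mul_mem ((gr s 0).smul_mem _ (w 0).2) ((gr s 0).sub_mem (one_mem_gr s)
    (gr_two (mul_mem_gr (o20 (toSMat x)) (o21 (toSMat x)))))

theorem scLift_mem {s : ℕ} (x : SVec matPar s) (w : SVec scPar s) : scLift x w ∈ SMat s := by
  have ht := half_smul_mul_mem x w
  have h00 := (Even s).mul_mem ht (e00 (toSMat x))
  have h01 := (Even s).mul_mem ht (e01 (toSMat x))
  have h10 := (Even s).mul_mem ht (e10 (toSMat x))
  have h11 := (Even s).mul_mem ht (e11 (toSMat x))
  have h02 := (gr s 1).add_mem (w 2).2 ((gr s 1).sub_mem (even_mul_odd h01 (o20 (toSMat x)))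
      (even_mul_odd h00 (o21 (toSMat x))))
  have h12 := (gr s 1).add_mem (w 3).2 ((gr s 1).sub_mem (even_mul_odd h11 (o20 (toSMat x)))
      (even_mul_odd h10 (o21 (toSMat x))))
  have z : (0 : ZMod 2) + 0 = 0 := by decide
  have z1 : (1 : ZMod 2) + 1 = 0 := by decide
  have z2 : (0 : ZMod 2) + 1 = 1 := by decide
  intro i j
  fin_cases i <;> fin_cases j
  · exact z.symm ▸ h00
  · exact z.symm ▸ h01
  · exact z2.symm ▸ h02
  · exact z.symm ▸ h10
  · exact z.symm ▸ h11
  · exact z2.symm ▸ h12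
  · exact Submodule.zero_mem _
  · exact Submodule.zero_mem _
  · exact z1.symm ▸ (w 1).2

/-- The tangent vector `scLift` fixes α and β and scales the upper left block by an even t. The
determinant equation then changes by 2t(1 + k), so t = w₀(1 - k)/2 is the right choice. The other
three equations are linear in e, γ and δ with coefficient 1, so these entries absorb the remaining
prescribed values, after correcting the column for the change of the block. -/
theorem surjective_fderiv_scEq {s : ℕ} {x : SVec matPar s} (hx : SCEqs (toSMat x).1) :
    Function.Surjective (fderiv ℂ (scEq s) x) := by
  refine surjective_fderiv_of_components sHolFun_scEq fun w => ?_
  have ht := half_smul_mul_mem x w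
  have hk := mul_odd_sq (o20 (toSMat x)) (o21 (toSMat x))
  have hd := hx.det
  change (x (2, 0) : OB s) * x (2, 1) * (x (2, 0) * x (2, 1)) = 0 at hk
  change (x (0, 0) : OB s) * x (1, 1) - x (1, 0) * x (0, 1) = 1 + x (2, 0) * x (2, 1) at hd
  refine ⟨smatCoord ⟨scLift x w, scLift_mem x w⟩, fun j => ?_⟩
  fin_cases j
  · refine (fderiv_scEq_det s x _).trans ?_
    simp only [smatCoord, scLift, Matrix.of_apply, Matrix.cons_val', Matrix.cons_val_zero,
      Matrix.cons_val_one, Matrix.cons_val, Fin.isValue, Fin.zero_eta]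
    generalize hT : (1 / 2 : ℂ) • (w 0 : OB s) * (1 - x (2, 0) * x (2, 1)) = t at ht ⊢
    have hc : ∀ a b : OB s, a * (t * b) + t * a * b = (t + t) * (a * b) := by
      intro a b
      rw [← mul_assoc, even_comm ht a, mul_assoc, add_mul]
    have h2 : t + t = w 0 * (1 - x (2, 0) * x (2, 1)) := by
      rw [← hT, ← add_mul, ← add_smul]
      norm_num
    rw [hc, hc, ← mul_sub, hd, h2, mul_assoc, sub_mul, mul_add, mul_add, hk]
    simp
  · refine (fderiv_scEq_corner s x _).trans ?_
    simp [smatCoord, scLift]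
  · refine (fderiv_column_eq s x _ (0, 2) (0, 1) (2, 0) (0, 0) (2, 1)).trans ?_
    simp [smatCoord, scLift]
  · refine (fderiv_column_eq s x _ (1, 2) (1, 1) (2, 0) (1, 0) (2, 1)).trans ?_
    simp [smatCoord, scLift]

/-- The solved equations already imply that the corner reduces to 1, so they cut out this component
globally and one chart domain suffices. Two even and two odd equations in dimension 5|4 leave 3|2.
-/
theorem isSupermanifold_SC : IsSupermanifold SCSpace 3 2 := by
  intro s₀ x₀
  refine ⟨Set.univ, isOpen_univ, Set.mem_univ _, 4, scPar, scEq,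
    sHolOn_of_components sHolFun_scEq _, ?_, ?_, ?_, ?_⟩
  · intro s y _
    refine Iff.trans ?_ (scEq_eq_zero_iff y).symm
    constructor
    · rintro ⟨L, rfl⟩
      exact SC.sCEqs L
    · intro h
      obtain ⟨L, hL⟩ := h.exists_point
      refine ⟨L, funext fun ij => Subtype.ext ?_⟩
      exact congrArg (fun M : SMat s => M.1 ij.1 ij.2) hL
  · intro s L _
    exact surjective_fderiv_scEq (SC.sCEqs L)
  · change 3 + Nat.card {j : Fin 4 // scPar j = 0} = Nat.card {i : Fin 3 × Fin 3 // matPar i = 0}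
    rw [Nat.card_eq_fintype_card, Nat.card_eq_fintype_card]
    decide
  · change 2 + Nat.card {j : Fin 4 // scPar j = 1} = Nat.card {i : Fin 3 × Fin 3 // matPar i = 1}
    rw [Nat.card_eq_fintype_card, Nat.card_eq_fintype_card]
    decide

theorem isSuperLieGroup_SL2 : IsSuperLieGroup SL2Space 3 0 :=
  ⟨isSupermanifold_SL2, isSHol_SL2_mul, isSHol_SL2_inv⟩

theorem isSuperLieGroup_SC : IsSuperLieGroup SCSpace 3 2 :=
  ⟨isSupermanifold_SC, isSHol_SC_mul, isSHol_SC_inv⟩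

end Manifolds

/-! ### The embedding of `SL_ℂ(2)` -/

/-- The upper left block of a point of `ℂ^{5|4}`. -/
def upperLeft (s : ℕ) (y : SVec matPar s) : SVec (fun _ : Fin 2 × Fin 2 => 0) s :=
  evenMatCoord !![⟨y (0, 0), e00 (toSMat y)⟩, ⟨y (0, 1), e01 (toSMat y)⟩;
    ⟨y (1, 0), e10 (toSMat y)⟩, ⟨y (1, 1), e11 (toSMat y)⟩]

theorem sHolFun_upperLeft (ij : Fin 2 × Fin 2) :
    SHolFun (fun s y => (upperLeft s y ij : OB s)) := by
  obtain ⟨i, j⟩ := ij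
  fin_cases i <;> fin_cases j
  exacts [.coord (0, 0), .coord (0, 1), .coord (1, 0), .coord (1, 1)]

theorem isSHol_toSC : IsSHol SL2Space SCSpace (fun s l => toSC s l) := by
  refine isSHol_of_global (g := fun s y => smatCoord (blockHom s (toEvenMat y))) ?_ ?_
  · intro ij
    exact sHolEvenMat_toEvenMat.block ij.1 ij.2
  · intro s l ij
    rfl

/-- Reading off the upper left block is a globally defined superholomorphic left inverse. -/
theorem isSEmbedding_toSC : IsSEmbedding SL2Space SCSpace (fun s l => toSC s l) := by
  refine ⟨isSHol_toSC, fun s => toSC_injective, fun s₀ x₀ => ⟨Set.univ, isOpen_univ,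
    Set.mem_univ _, upperLeft, sHolOn_of_components sHolFun_upperLeft _, fun s l _ => ?_⟩⟩
  funext ⟨i, j⟩
  apply Subtype.ext
  fin_cases i <;> fin_cases j <;> rfl

/-! ### The product decomposition -/

theorem isSHol_toSC_mul_susy : IsSHol (prodSpace SL2Space C02) SCSpace
    (fun s x => (toSC s x.1 * susy s x.2 : SC s)) := by
  refine isSHol_of_global (g := fun s x => smatCoord
    (blockHom s (toEvenMat (fun ij => x (Sum.inl ij))) *
      susySMat (fun i => x (Sum.inr i)))) ?_ ?_
  · intro ij
    have h1 : SHolEvenMat (p := (prodSpace SL2Space C02).par)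
        (fun s x => toEvenMat (fun ij => x (Sum.inl ij))) := fun i j => .coord (Sum.inl (i, j))
    have h2 : SHolSMat (p := (prodSpace SL2Space C02).par)
        (fun s x => susySMat (fun i => x (Sum.inr i))) := sHolSMat_susy fun i => .coord (Sum.inr i)
    exact (h1.block.mul h2) ij.1 ij.2
  · intro s x ij
    rfl

/-- The odd entries in the last row of a point of `ℂ^{5|4}`. -/
def lastRow (s : ℕ) (y : SVec matPar s) : SVec oddPar s := fun i => ⟨y (2, i.castSucc), by
  fin_cases i
  exacts [o20 (toSMat y), o21 (toSMat y)]⟩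

theorem sHolFun_lastRow (i : Fin 2) : SHolFun (fun s y => (lastRow s y i : OB s)) := by
  change SHolFun (fun s (y : SVec matPar s) => (y (2, i.castSucc) : OB s))
  exact .coord (2, i.castSucc)

theorem isSHol_odd : IsSHol SCSpace C02 (fun _ L => SC.odd L) :=
  isSHol_of_global (g := lastRow) sHolFun_lastRow fun _ _ _ => rfl

theorem isSIso_toSC_mul_susy : IsSIso (prodSpace SL2Space C02) SCSpace
    (fun s x => (toSC s x.1 * susy s x.2 : SC s)) := by
  refine ⟨isSHol_toSC_mul_susy, fun s L => (SC.even L, SC.odd L), ?_, ?_, ?_⟩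
  · refine isSHol_of_global (g := fun s y => Sum.rec
      (fun ij => evenMatCoord (slBlock (toSMat y)) ij) (fun i => lastRow s y i)) ?_ ?_
    · rintro (ij | i)
      · exact sHolSMat_toSMat.slBlock ij.1 ij.2
      · exact sHolFun_lastRow i
    · rintro s L (ij | i) <;> rfl
  · rintro s ⟨l, v⟩
    exact Prod.ext (SC.even_toSC_mul_susy l v) (SC.odd_toSC_mul_susy l v)
  · intro s L
    exact SC.toSC_even_mul_susy_odd L

theorem existsUnique_toSC_mul_susy (s : ℕ) (L : SC s) :
    ∃! x : SL2 s × SVec oddPar s, toSC s x.1 * susy s x.2 = L := by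
  refine ⟨(SC.even L, SC.odd L), SC.toSC_even_mul_susy_odd L, ?_⟩
  rintro ⟨l, v⟩ rfl
  exact (Prod.ext (SC.even_toSC_mul_susy l v) (SC.odd_toSC_mul_susy l v)).symm

/-! ### The coset space -/

/-- The bijection from the cosets onto the points of `ℂ^{0|2}`. -/
def cosetEquiv (s : ℕ) : Coset s ≃ SVec oddPar s where
  toFun := Quotient.lift SC.odd fun L N h => by
    obtain ⟨l, hl⟩ := QuotientGroup.rightRel_apply.mp h
    exact (SC.odd_eq_iff L N).mpr ⟨l, by rw [hl, inv_mul_cancel_right]⟩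
  invFun v := cosetMk s (susy s v)
  left_inv := by
    rintro ⟨L⟩
    -- The coset of L contains S(α, β) because L S(α, β)⁻¹ is the image of the SL₂-component of L.
    refine Quotient.sound (QuotientGroup.rightRel_apply.mpr ⟨SC.even L, ?_⟩)
    exact eq_mul_inv_of_mul_eq (SC.toSC_even_mul_susy_odd L)
  right_inv v := susy_odd v

theorem cosetEquiv_cosetMk (s : ℕ) (L : SC s) : cosetEquiv s (cosetMk s L) = SC.odd L := rfl

/-- On the point `ℝ^{0|0}` every function is constant. -/
theorem algebraMap_body (x : OB 0) : algebraMap ℂ (OB 0) (body 0 x) = x := by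
  have hg : ∀ w : Gras 0, algebraMap ℂ (OB 0) (body 0 (gen w)) = gen w := by
    intro w
    induction w using ExteriorAlgebra.induction with
    | algebraMap r => rw [gen_algebraMap, AlgHom.commutes]; rfl
    | ι v =>
      have h : (gen (ExteriorAlgebra.ι ℝ v) : OB 0) = 0 := by
        rw [Subsingleton.elim v 0, map_zero]
        exact TensorProduct.tmul_zero _ _
      rw [h, map_zero, map_zero]
    | mul a b ha hb => rw [gen_mul', map_mul, map_mul, ha, hb]
    | add a b ha hb => rw [gen_add, map_add, map_add, ha, hb]
  induction x using OB.induction with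
  | zero => rw [map_zero, map_zero]
  | tmul z w => rw [map_smul, smul_eq_mul, map_mul, hg, Algebra.smul_def]
  | add a b ha hb => rw [map_add, map_add, ha, hb]

/-- The reduction of a point of `SL_ℂ(2)`, as a constant point over another superpoint. -/
def constSL {t : ℕ} (l : SL2 t) (s : ℕ) : SL2 s :=
  Matrix.SpecialLinearGroup.map
    ((algebraMap ℂ (Even s)).comp ((body t : OB t →+* ℂ).comp (Even t).val.toRingHom)) l

/-- Over the point without odd generators reduction loses nothing. This makes the local section
built from `constSL` pass through the prescribed reduced point. -/
theorem constSL_zero (l : SL2 0) : constSL l 0 = l := by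
  ext i j
  exact algebraMap_body (l.1 i j)

theorem isSHol_susy : SHolOn (p := oddPar) (q := matPar) Set.univ
    (fun _ v => smatCoord (susySMat v)) :=
  sHolOn_of_components (fun ij => sHolSMat_susy (fun i => .coord i) ij.1 ij.2) _

/-- Odd parameters have zero body, so every supersymmetry transformation reduces to the identity
matrix. All of them therefore lie over a single reduced point. -/
theorem red_susy {s t : ℕ} (v : SVec oddPar s) (w : SVec oddPar t) :
    (smatCoord (susySMat v)).red = (smatCoord (susySMat w)).red := by
  have h : ∀ {s : ℕ} (v : SVec oddPar s) (i j : Fin 3),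
      body s ((susySMat v).1 i j) = (1 : Matrix (Fin 3) (Fin 3) ℂ) i j := by
    intro s v i j
    have h0 := body_odd (v 0).2
    have h1 := body_odd (v 1).2
    fin_cases i <;> fin_cases j <;> simp [susySMat, susyMat, h0, h1]
  funext ij
  exact (h v ij.1 ij.2).trans (h w ij.1 ij.2).symm

theorem susy_map {s t : ℕ} (φ : SPHom s t) (v : SVec oddPar s) :
    susy t (v.map φ) = SC.map φ (susy s v) := by
  have h := isSHol_susy.natural s t φ v (Set.mem_univ _)
  exact SCSpace.coord_injective t h

/-- A local representative of h near one supersymmetry transformation is valid at all of them, since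
they share their reduction. The composite thus has one representative on the whole of ℂ^{0|2}. -/
theorem isSHol_comp_susy {Y : SSpace} {h : ∀ s, SCSpace.pts s → Y.pts s}
    (hh : IsSHol SCSpace Y h) : IsSHol C02 Y (fun s v => h s (susy s v)) := by
  refine ⟨fun s t φ v => ?_, fun s₀ v₀ => ?_⟩
  · exact (congrArg (h t) (susy_map φ v)).trans (hh.1 s t φ (susy s v))
  · obtain ⟨U, hU, hmem, g, hg, hgh⟩ := hh.2 s₀ (susy s₀ v₀)
    have hdom : ∀ s (v : SVec oddPar s), smatCoord (susySMat v) ∈ dom matPar U s := by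
      intro s v
      have : (smatCoord (susySMat v)).red ∈ U := by
        rw [red_susy v v₀]
        exact hmem
      exact this
    exact ⟨Set.univ, isOpen_univ, Set.mem_univ _, fun s v => g s (smatCoord (susySMat v)),
      hg.comp_of_mapsTo hU isSHol_susy hdom, fun s v _ => hgh s (susy s v) (hdom s v)⟩

theorem isSQuotient_odd : IsSQuotient SL2Space SCSpace C02 leftAct (fun _ L => SC.odd L) where
  shol := isSHol_odd
  surjective s v := ⟨susy s v, susy_odd v⟩
  orbits s L N := SC.odd_eq_iff L N
  submersion := by
    intro (x₀ : SC 0)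
    -- The section is v ↦ ι(l₀) S(v), with l₀ the SL₂-component of the given point. Its entries are
    -- complex constants, extended to every superpoint, which keeps the section natural.
    refine ⟨Set.univ, isOpen_univ, Set.mem_univ _, fun s v => smatCoord
      (blockHom s (constSL (SC.even x₀) s).1 * susySMat v), ?_, ?_, ?_⟩
    · refine sHolOn_of_components (fun ij => ?_) _
      have h1 : SHolEvenMat (p := oddPar) (fun s _ => (constSL (SC.even x₀) s).1) :=
        fun i j => .const _
      exact (h1.block.mul (sHolSMat_susy fun i => .coord i)) ij.1 ij.2
    · change SCSpace.coord (toSC 0 (constSL (SC.even x₀) 0) * susy 0 (SC.odd x₀) : SC 0) = _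
      rw [constSL_zero, SC.toSC_even_mul_susy_odd]
    · intro s v _
      exact ⟨(toSC s (constSL (SC.even x₀) s) * susy s v : SC s), rfl,
        SC.odd_toSC_mul_susy _ v⟩
  universal := by
    intro Y h hh hinv
    -- Invariance gives h(L) = h(S(v)) for v the odd row of L, so restriction along the section S is
    -- a factorisation. It is the only one because S is a section of the quotient map.
    refine ⟨fun s v => h s (susy s v), ⟨isSHol_comp_susy hh, fun s L => ?_⟩, ?_⟩
    · have := hinv s (SC.even L) (susy s (SC.odd L))
      exact this.symm.trans (congrArg (h s) (SC.toSC_even_mul_susy_odd L))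
    · rintro h' ⟨-, hh'⟩
      funext s v
      exact (congrArg (h' s) (susy_odd v).symm).trans (hh' s (susy s v))

end SG

end

theorem mainTheorem6 :
    -- both groups are complex super Lie groups
    SG.IsSuperLieGroup SG.SL2Space 3 0 ∧
    SG.IsSuperLieGroup SG.SCSpace 3 2 ∧
    -- the group homomorphism `l ↦ diag(l, 1)` is an embedding
    SG.IsSEmbedding SG.SL2Space SG.SCSpace (fun s l => SG.toSC s l) ∧
    -- the coset space is isomorphic to `ℂ^{0|2}`, via the supersymmetry matrices
    (∃ Ψ : ∀ s : ℕ, SG.Coset s ≃ SG.SVec SG.oddPar s,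
      SG.IsSQuotient SG.SL2Space SG.SCSpace SG.C02 SG.leftAct
        (fun s L => Ψ s (SG.cosetMk s L)) ∧
      ∀ (s : ℕ) (v : SG.SVec SG.oddPar s), Ψ s (SG.cosetMk s (SG.susy s v)) = v) ∧
    -- the product map is an isomorphism of complex supermanifolds
    SG.IsSIso (SG.prodSpace SG.SL2Space SG.C02) SG.SCSpace
      (fun s x => (SG.toSC s x.1 * SG.susy s x.2 : SG.SC s)) ∧
    -- every point factors uniquely
    ∀ (s : ℕ) (L : SG.SC s), ∃! x : SG.SL2 s × SG.SVec SG.oddPar s,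
      SG.toSC s x.1 * SG.susy s x.2 = L := by
  refine ⟨SG.isSuperLieGroup_SL2, SG.isSuperLieGroup_SC, SG.isSEmbedding_toSC,
    ⟨SG.cosetEquiv, SG.isSQuotient_odd, fun s v => ?_⟩, SG.isSIso_toSC_mul_susy,
    SG.existsUnique_toSC_mul_susy⟩
  rw [SG.cosetEquiv_cosetMk, SG.susy_odd]
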